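/- Let $G$ be a finite graph, in which loops and multiple edges are allowed, and suppose that every vertex of $G$ has degree at most $4$ (a loop contributes $2$ to the degree of its vertex). Then $G$ has a strong edge-coloring with at most $22$ colors, that is, one can assign to each edge of $G$ one of $22$ colors so that any two distinct edges $e \ne f$ receive different colors whenever $e$ and $f$ have a common endpoint, or some edge of $G$ joins an endpoint of $e$ to an endpoint of $f$. -/

import Mathlib

namespace Graph

/-- The degree of a vertex of a multigraph, as an extended natural number: the number of edges
incident to it, where a loop counts twice. -/
noncomputable def degree {α β : Type*} (G : Graph α β) (x : α) : ℕ∞ :=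
  (G.incidenceSet x).encard + (G.loopSet x).encard

/-- Distinct edges with a common endpoint receive distinct colors.
(Only the values of `c` on edges of `G` matter.) -/
def IsProperEdgeColoring {α β C : Type*} (G : Graph α β) (c : β → C) : Prop :=
  ∀ ⦃e f : β⦄ ⦃x : α⦄, G.Inc e x → G.Inc f x → e ≠ f → c e ≠ c f

/-- A proper edge-coloring in which, moreover, the first and the last edge of a path `w x y z` of
length three never receive the same color. The vertices are not required to be distinct: this
changes nothing for loopless graphs, since then distinct `e` and `f` have a common endpoint as soon
as two of the vertices coincide, and it lets a loop `e` (the case `w = x`) conflict with the edges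
at distance one from it. -/
structure IsStrongEdgeColoring {α β C : Type*} (G : Graph α β) (c : β → C) : Prop where
  proper : G.IsProperEdgeColoring c
  ne_of_path : ∀ ⦃e g f : β⦄ ⦃w x y z : α⦄,
    G.IsLink e w x → G.IsLink g x y → G.IsLink f y z → e ≠ f → c e ≠ c f

end Graph

/-!
Two edges conflict when they are at distance at most two in the line graph, so an edge has at most
`24` conflicts. Fix a vertex `v` and color the edges of its component greedily, in order of
decreasing distance from `v`. An edge that is not at `v` precedes all the edges at the next vertex
towards `v`, so at least four of its conflicts are still uncolored and a color remains for it. Only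
the edges at `v` can get stuck, and it suffices to find one vertex `v` for which they do not.

The conflicts are overcounted at a vertex of degree at most three, on a loop, at parallel edges and
on a triangle, and these cases are easy. Otherwise the component is simple, triangle-free and
`4`-regular. There every 4-cycle through an edge at `v` saves one of its `24` conflicts, and an
induced matching of edges at distance one from `v`, colored alike at the start, saves all but one of
its edges at every edge at `v`. If there are few 4-cycles then there is a large induced matching,
and the two savings together are enough at some vertex.

Infinite graphs are covered by the theorem of de Bruijn and Erdős.
-/

namespace StrongEdgeColoring

open Finset
open scoped Classical

noncomputable section

section InducedMatching

variable {V : Type*} {Γ : SimpleGraph V} {v : V} {k : ℕ}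

/-- Two edges, written as ordered pairs, with distinct first endpoints and no edge of `Γ` joining
them, the first endpoints excepted. When the first endpoints are distinct vertices of an
independent set, this says that the edges form an induced matching. -/
structure Separated (Γ : SimpleGraph V) (q q' : V × V) : Prop where
  fst_ne : q.1 ≠ q'.1
  not_adj_fst_snd : ¬Γ.Adj q.1 q'.2
  not_adj_snd_fst : ¬Γ.Adj q.2 q'.1
  not_adj_snd_snd : ¬Γ.Adj q.2 q'.2

theorem Separated.symm {q q' : V × V} (h : Separated Γ q q') : Separated Γ q' q :=
  ⟨h.fst_ne.symm, fun hadj => h.not_adj_snd_fst hadj.symm,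
    fun hadj => h.not_adj_fst_snd hadj.symm, fun hadj => h.not_adj_snd_snd hadj.symm⟩

/-- A family of pairwise separated edges at distance one from `v`, each oriented away from `v`. -/
structure IsInducedMatchingAt (Γ : SimpleGraph V) (v : V) (q : Fin k → V × V) : Prop where
  adj_fst (i : Fin k) : Γ.Adj v (q i).1
  adj (i : Fin k) : Γ.Adj (q i).1 (q i).2
  snd_ne (i : Fin k) : (q i).2 ≠ v
  separated : Pairwise fun i j => Separated Γ (q i) (q j)

theorem IsInducedMatchingAt.empty : IsInducedMatchingAt Γ v ![] :=
  ⟨finZeroElim, finZeroElim, finZeroElim, Subsingleton.pairwise⟩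

theorem IsInducedMatchingAt.cons {q : Fin k → V × V} (hq : IsInducedMatchingAt Γ v q) {u w : V}
    (hvu : Γ.Adj v u) (huw : Γ.Adj u w) (hwv : w ≠ v) (hsep : ∀ i, Separated Γ (u, w) (q i)) :
    IsInducedMatchingAt Γ v (Matrix.vecCons (u, w) q) where
  adj_fst := Fin.cases hvu hq.adj_fst
  adj := Fin.cases huw hq.adj
  snd_ne := Fin.cases hwv hq.snd_ne
  separated i j := by
    cases i using Fin.cases <;> cases j using Fin.cases
    case zero.zero => exact fun h => absurd rfl h
    case zero.succ j => exact fun _ => hsep j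
    case succ.zero i => exact fun _ => (hsep i).symm
    case succ.succ i j => exact fun hij => hq.separated (ne_of_apply_ne Fin.succ hij)

end InducedMatching

section GoodRoot

variable {V : Type*} {Γ : SimpleGraph V} {u v w x y : V}

theorem not_adj_of_cliqueFree_three (htri : Γ.CliqueFree 3) (hu : Γ.Adj v u) (hw : Γ.Adj v w) :
    ¬Γ.Adj u w := fun huw =>
  Γ.isIndepSet_neighborSet_of_triangleFree htri v hu hw huw.ne huw

theorem exists_independent_transversal {s : Fin 3 → Finset V} (htri : Γ.CliqueFree 3)
    (hs : ∀ i, 1 < #(s i)) (hmatch : ∀ i j, i ≠ j →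
      ∀ a ∈ s i, ∀ b ∈ s j, ∀ b' ∈ s j, Γ.Adj a b → Γ.Adj a b' → b = b') :
    ∃ f : Fin 3 → V, (∀ i, f i ∈ s i) ∧ Pairwise fun i j => ¬Γ.Adj (f i) (f j) := by
  by_contra! hcon
  have hcon : ∀ a ∈ s 0, ∀ b ∈ s 1, ∀ c ∈ s 2, ¬Γ.Adj a b → ¬Γ.Adj a c → Γ.Adj b c := by
    intro a ha b hb c hc hab hac
    by_contra hbc
    refine hcon ![a, b, c] (Fin.forall_fin_succ.2 ⟨ha, Fin.forall_fin_two.2 ⟨hb, hc⟩⟩) ?_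
    rintro i j hij
    fin_cases i <;> fin_cases j <;> simp_all [Γ.adj_comm]
  have hmiss : ∀ i j, i ≠ j → ∀ a ∈ s i, ∃ b ∈ s j, ¬Γ.Adj a b := by
    intro i j hij a ha
    by_contra! hall
    obtain ⟨b, hb, b', hb', hbb⟩ := one_lt_card.1 (hs j)
    exact hbb (hmatch i j hij a ha b hb b' hb' (hall b hb) (hall b' hb'))
  obtain ⟨a, ha, a', ha', haa⟩ := one_lt_card.1 (hs 0)
  obtain ⟨b, hb, hab⟩ : ∃ b ∈ s 1, Γ.Adj a b := by
    by_contra! hall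
    obtain ⟨c, hc, hac⟩ := hmiss 0 2 (by decide) a ha
    obtain ⟨b, hb, hcb⟩ := hmiss 2 1 (by decide) c hc
    exact hcb (hcon a ha b hb c hc (hall b hb) hac).symm
  obtain ⟨c, hc, hac⟩ : ∃ c ∈ s 2, Γ.Adj a c := by
    by_contra! hall
    obtain ⟨b, hb, hab⟩ := hmiss 0 1 (by decide) a ha
    obtain ⟨c, hc, hbc⟩ := hmiss 1 2 (by decide) b hb
    exact hbc (hcon a ha b hb c hc hab (hall c hc))
  have hba' : ¬Γ.Adj a' b := fun h => haa (hmatch 1 0 (by decide) b hb a ha a' ha' hab.symm h.symm)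
  have hca' : ¬Γ.Adj a' c := fun h => haa (hmatch 2 0 (by decide) c hc a ha a' ha' hac.symm h.symm)
  exact not_adj_of_cliqueFree_three htri hab hac (hcon a' ha' b hb c hc hba' hca')

variable [Γ.LocallyFinite]

/-- The 4-cycles `v y w u` through the edge `vu`, encoded as pairs `(y, w)`. -/
def squares (Γ : SimpleGraph V) [Γ.LocallyFinite] (v u : V) : Finset (V × V) :=
  Γ.interedges ((Γ.neighborFinset v).erase u) ((Γ.neighborFinset u).erase v)

theorem mem_squares :
    (y, w) ∈ squares Γ v u ↔ (Γ.Adj v y ∧ y ≠ u) ∧ (Γ.Adj u w ∧ w ≠ v) ∧ Γ.Adj y w := by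
  simp only [squares, SimpleGraph.mk_mem_interedges_iff, mem_erase, SimpleGraph.mem_neighborFinset,
    and_comm]

/-- The vertices from which Cranston's greedy coloring succeeds: an induced matching of size `k`
at distance one from `v` can be given a single color, saving `k - 1` colors at every edge at `v`,
and each 4-cycle through an edge at `v` saves one further color there. The three edges `v (u i)`
are the last ones to be colored. -/
def IsGoodRoot (Γ : SimpleGraph V) [Γ.LocallyFinite] (v : V) : Prop :=
  ∃ (k : ℕ) (q : Fin k → V × V), IsInducedMatchingAt Γ v q ∧
    ∃ u : Fin 3 ↪ V, ∀ i, Γ.Adj v (u i) ∧ 3 ≤ #(squares Γ v (u i)) + (k - 1) + i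

theorem mem_squares_swap (h : (y, w) ∈ squares Γ v u) (hvu : Γ.Adj v u) :
    (u, w) ∈ squares Γ v y := by
  obtain ⟨⟨-, hyu⟩, ⟨huw, hwv⟩, hyw⟩ := mem_squares.1 h
  exact mem_squares.2 ⟨⟨hvu, hyu.symm⟩, ⟨hyw, hwv⟩, huw⟩

theorem mem_squares_rotate (h : (y, w) ∈ squares Γ v u) (hvu : Γ.Adj v u) :
    (v, y) ∈ squares Γ u w := by
  obtain ⟨⟨hvy, hyu⟩, ⟨-, hwv⟩, hyw⟩ := mem_squares.1 h
  exact mem_squares.2 ⟨⟨hvu.symm, hwv.symm⟩, ⟨hyw.symm, hyu⟩, hvy⟩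

section FourRegular

variable (hreg : Γ.IsRegularOfDegree 4)
include hreg

theorem exists_embedding_fin_three_neighbors (hu : Γ.Adj v u) (hw : Γ.Adj v w) (huw : u ≠ w) :
    ∃ f : Fin 3 ↪ V, f 0 = u ∧ f 1 = w ∧ ∀ i, Γ.Adj v (f i) := by
  obtain ⟨t, ht, htuw⟩ : ∃ t ∈ Γ.neighborFinset v, t ∉ ({u, w} : Finset V) :=
    exists_mem_notMem_of_card_lt_card
      (card_le_two.trans_lt (by rw [Γ.card_neighborFinset_eq_degree, hreg.degree_eq]; simp))
  rw [mem_insert, mem_singleton, not_or] at htuw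
  rw [SimpleGraph.mem_neighborFinset] at ht
  refine ⟨⟨![u, w, t], ?_⟩, rfl, rfl, ?_⟩
  · rw [← List.nodup_ofFn]
    simp [huw, Ne.symm htuw.1, Ne.symm htuw.2]
  · exact Fin.forall_fin_succ.2 ⟨hu, Fin.forall_fin_two.2 ⟨hw, ht⟩⟩

theorem exists_adj_pair_ne (v : V) : ∃ u w, Γ.Adj v u ∧ Γ.Adj v w ∧ u ≠ w := by
  have hcard : 1 < #(Γ.neighborFinset v) := by
    rw [Γ.card_neighborFinset_eq_degree, hreg.degree_eq]
    simp
  obtain ⟨u, hu, w, hw, huw⟩ := one_lt_card.1 hcard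
  exact ⟨u, w, by simpa using hu, by simpa using hw, huw⟩

theorem isGoodRoot_of_inducedMatching {q : Fin 4 → V × V} (hq : IsInducedMatchingAt Γ v q) :
    IsGoodRoot Γ v := by
  obtain ⟨u, w, hu, hw, huw⟩ := exists_adj_pair_ne hreg v
  obtain ⟨f, -, -, hf⟩ := exists_embedding_fin_three_neighbors hreg hu hw huw
  exact ⟨4, q, hq, f, fun i => ⟨hf i, by omega⟩⟩

theorem isGoodRoot_of_squares_nonempty {q : Fin 3 → V × V} (hq : IsInducedMatchingAt Γ v q)
    (hu : Γ.Adj v u) (h : (w, x) ∈ squares Γ v u) : IsGoodRoot Γ v := by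
  obtain ⟨⟨hvw, hwu⟩, -⟩ := mem_squares.1 h
  obtain ⟨f, rfl, -, hf⟩ := exists_embedding_fin_three_neighbors hreg hu hvw hwu.symm
  have hpos : 0 < #(squares Γ v (f 0)) := card_pos.2 ⟨_, h⟩
  refine ⟨3, q, hq, f, fun i => ⟨hf i, ?_⟩⟩
  match i with
  | 0 => exact Nat.add_le_add_right hpos 2
  | 1 | 2 => simp

theorem isGoodRoot_of_two_le_card_squares {q : Fin 2 → V × V} (hq : IsInducedMatchingAt Γ v q)
    (hu : Γ.Adj v u) (h : 2 ≤ #(squares Γ v u)) : IsGoodRoot Γ v := by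
  obtain ⟨⟨w, x⟩, hwx⟩ := card_pos.1 (two_pos.trans_le h)
  obtain ⟨⟨hvw, hwu⟩, -⟩ := mem_squares.1 hwx
  obtain ⟨f, rfl, rfl, hf⟩ := exists_embedding_fin_three_neighbors hreg hu hvw hwu.symm
  have hpos : 0 < #(squares Γ v (f 1)) := card_pos.2 ⟨_, mem_squares_swap hwx hu⟩
  refine ⟨2, q, hq, f, fun i => ⟨hf i, ?_⟩⟩
  match i with
  | 0 => exact Nat.add_le_add_right h 1
  | 1 => exact Nat.add_le_add_right hpos 2
  | 2 => simp

theorem isGoodRoot_of_common_neighbors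
    (h : ∀ y, Γ.Adj v y → ∀ u, Γ.Adj v u → y ≠ u → ∃ w ≠ v, Γ.Adj y w ∧ Γ.Adj u w) :
    IsGoodRoot Γ v := by
  have three_le : ∀ u, Γ.Adj v u → 3 ≤ #(squares Γ v u) := fun u hu => by
    have hsub : (Γ.neighborFinset v).erase u ⊆ (squares Γ v u).image Prod.fst := fun y hy => by
      rw [mem_erase, SimpleGraph.mem_neighborFinset] at hy
      obtain ⟨w, hwv, hyw, huw⟩ := h y hy.2 u hu hy.1
      exact mem_image.2 ⟨(y, w), mem_squares.2 ⟨hy.symm, ⟨huw, hwv⟩, hyw⟩, rfl⟩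
    have hcard : #((Γ.neighborFinset v).erase u) = 3 := by
      rw [card_erase_of_mem (by simpa using hu), Γ.card_neighborFinset_eq_degree, hreg.degree_eq]
    exact hcard ▸ (card_le_card hsub).trans card_image_le
  obtain ⟨u, w, hu, hw, huw⟩ := exists_adj_pair_ne hreg v
  obtain ⟨f, -, -, hf⟩ := exists_embedding_fin_three_neighbors hreg hu hw huw
  exact ⟨0, ![], .empty, f, fun i => ⟨hf i, (three_le _ (hf i)).trans (by omega)⟩⟩

theorem one_lt_card_neighborFinset_erase_sdiff {d : V} (huv : Γ.Adj u v)
    (h : ∀ a, Γ.Adj u a → a ≠ v → Γ.Adj d a → ∀ b, Γ.Adj u b → b ≠ v → Γ.Adj d b → a = b) :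
    1 < #((Γ.neighborFinset u).erase v \ Γ.neighborFinset d) := by
  have hinter : #((Γ.neighborFinset u).erase v ∩ Γ.neighborFinset d) ≤ 1 := by
    simp only [card_le_one, mem_inter, mem_erase, SimpleGraph.mem_neighborFinset]
    exact fun a ha b hb => h a ha.1.2 ha.1.1 ha.2 b hb.1.2 hb.1.1 hb.2
  have hsum := card_sdiff_add_card_inter ((Γ.neighborFinset u).erase v) (Γ.neighborFinset d)
  rw [card_erase_of_mem (by simpa using huv), Γ.card_neighborFinset_eq_degree,
    hreg.degree_eq] at hsum
  omega

theorem neighborFinset_eq_of_forall_adj {y y' : V} (htri : Γ.CliqueFree 3) (hvy : Γ.Adj v y)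
    (hvy' : Γ.Adj v y') (hyw : Γ.Adj y w) (h : ∀ z, Γ.Adj y' z → z ≠ v → Γ.Adj w z) :
    Γ.neighborFinset w = insert y ((Γ.neighborFinset y').erase v) := by
  refine (eq_of_subset_of_card_le ?_ ?_).symm
  · intro z
    simp only [mem_insert, mem_erase, SimpleGraph.mem_neighborFinset]
    rintro (rfl | ⟨hzv, hz⟩)
    exacts [hyw.symm, h z hz hzv]
  · have hy : y ∉ (Γ.neighborFinset y').erase v := fun hy =>
      not_adj_of_cliqueFree_three htri hvy' hvy (by simpa using mem_of_mem_erase hy)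
    rw [card_insert_of_notMem hy, card_erase_of_mem (by simpa using hvy'.symm)]
    simp only [Γ.card_neighborFinset_eq_degree, hreg.degree_eq, le_refl]

/-- If no two edges at distance one from `v` are separated, two neighbors `y` and `y'` of `v`
without a second common neighbor span a complete bipartite graph between their remaining
neighbors, so any two neighbors `w` and `w'` of `y` other than `v` are twins. -/
theorem exists_isGoodRoot_of_two_le_card_squares (htri : Γ.CliqueFree 3) (hvu : Γ.Adj v u)
    (h2 : 2 ≤ #(squares Γ v u)) : ∃ w, IsGoodRoot Γ w := by
  by_contra! hroot
  have hadj : ∀ y w y' w', Γ.Adj v y → Γ.Adj y w → w ≠ v → Γ.Adj v y' → Γ.Adj y' w' → w' ≠ v →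
      y ≠ y' → ¬Γ.Adj y w' → ¬Γ.Adj w y' → Γ.Adj w w' := by
    intro y w y' w' hvy hyw hwv hvy' hyw' hwv' hne h₁ h₂
    by_contra h₃
    exact hroot v (isGoodRoot_of_two_le_card_squares hreg ((IsInducedMatchingAt.empty.cons hvy' hyw'
      hwv' finZeroElim).cons hvy hyw hwv (Fin.forall_fin_one.2 ⟨hne, h₁, h₂, h₃⟩)) hvu h2)
  obtain ⟨y, hvy, y', hvy', hne, hcommon⟩ : ∃ y, Γ.Adj v y ∧ ∃ y', Γ.Adj v y' ∧ y ≠ y' ∧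
      ∀ w ≠ v, Γ.Adj y w → ¬Γ.Adj y' w := by
    by_contra! hcon
    exact hroot v (isGoodRoot_of_common_neighbors hreg hcon)
  have hjoin : ∀ w w', Γ.Adj y w → w ≠ v → Γ.Adj y' w' → w' ≠ v → Γ.Adj w w' :=
    fun w w' hyw hwv hyw' hwv' => hadj y w y' w' hvy hyw hwv hvy' hyw' hwv' hne
      (fun h => hcommon w' hwv' h hyw') (fun h => hcommon w hwv hyw h.symm)
  obtain ⟨w, hw, w', hw', hww⟩ : ∃ w, (Γ.Adj y w ∧ w ≠ v) ∧
      ∃ w', (Γ.Adj y w' ∧ w' ≠ v) ∧ w' ≠ w := by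
    have hcard : 1 < #((Γ.neighborFinset y).erase v) := by
      rw [card_erase_of_mem (by simpa using hvy.symm), Γ.card_neighborFinset_eq_degree,
        hreg.degree_eq]
      simp
    obtain ⟨w, hw, w', hw', hne⟩ := one_lt_card.1 hcard
    exact ⟨w, by simpa [and_comm] using hw, w', by simpa [and_comm] using hw', hne.symm⟩
  suffices htwin : ∀ z, Γ.Adj w z → Γ.Adj z w' from hroot w
    (isGoodRoot_of_common_neighbors hreg fun z hz t ht _ => ⟨w', hww, htwin z hz, htwin t ht⟩)
  intro z hz
  rw [← SimpleGraph.mem_neighborFinset, neighborFinset_eq_of_forall_adj hreg htri hvy hvy' hw.1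
    fun z hz hzv => hjoin w z hw.1 hw.2 hz hzv] at hz
  simp only [mem_insert, mem_erase, SimpleGraph.mem_neighborFinset] at hz
  rcases hz with rfl | ⟨hzv, hz⟩
  exacts [hw'.1, (hjoin w' z hw'.1 hw'.2 hz hzv).symm]

end FourRegular

section AtMostOneSquare

variable (hle : ∀ v u, Γ.Adj v u → #(squares Γ v u) ≤ 1)
include hle

theorem eq_of_mem_squares {y' w' : V} (hvu : Γ.Adj v u) (h : (y, w) ∈ squares Γ v u)
    (h' : (y', w') ∈ squares Γ v u) : y = y' ∧ w = w' :=
  Prod.ext_iff.1 (card_le_one.1 (hle v u hvu) _ h _ h')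

theorem not_adj_of_mem_squares {p : V} (hvu : Γ.Adj v u) (h : (y, x) ∈ squares Γ v u)
    (hup : Γ.Adj u p) (hpv : p ≠ v) (hpx : p ≠ x) (hwu : w ≠ u) (hxw : Γ.Adj x w) :
    ¬Γ.Adj p w := fun hpw =>
  hpv (eq_of_mem_squares hle (mem_squares.1 h).2.1.1
    (mem_squares.2 ⟨⟨hup, hpx⟩, ⟨hxw, hwu⟩, hpw⟩) (mem_squares_rotate h hvu)).1

theorem separated_of_mem_squares {j p : V} (hvu : Γ.Adj v u) (h : (y, x) ∈ squares Γ v u)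
    (hvj : Γ.Adj v j) (hju : j ≠ u) (hjy : j ≠ y) (hup : Γ.Adj u p) (hpv : p ≠ v)
    (hjw : Γ.Adj j w) (hwv : w ≠ v) (hpw : ¬Γ.Adj p w) : Separated Γ (u, p) (j, w) :=
  have hfar : ∀ z, Γ.Adj u z → z ≠ v → ¬Γ.Adj j z := fun _ huz hzv hjz =>
    hjy (eq_of_mem_squares hle hvu (mem_squares.2 ⟨⟨hvj, hju⟩, ⟨huz, hzv⟩, hjz⟩) h).1
  ⟨hju.symm, fun huw => hfar w huw hwv hjw, fun hpj => hfar p hup hpv hpj.symm, hpw⟩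

theorem exists_separated (hreg : Γ.IsRegularOfDegree 4) (htri : Γ.CliqueFree 3) {u' : V}
    (hvu : Γ.Adj v u) (hvu' : Γ.Adj v u') (hne : u ≠ u') :
    ∃ b c, (Γ.Adj u b ∧ b ≠ v) ∧ (Γ.Adj u' c ∧ c ≠ v) ∧ Separated Γ (u, b) (u', c) := by
  have hcard : ∀ u u', Γ.Adj v u → Γ.Adj v u' → u ≠ u' →
      1 < #((Γ.neighborFinset u).erase v \ Γ.neighborFinset u') := fun u u' hvu hvu' hne =>
    one_lt_card_neighborFinset_erase_sdiff hreg hvu.symm fun a hua hav hu'a b hub hbv hu'b =>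
      (eq_of_mem_squares hle hvu (mem_squares.2 ⟨⟨hvu', hne.symm⟩, ⟨hua, hav⟩, hu'a⟩)
        (mem_squares.2 ⟨⟨hvu', hne.symm⟩, ⟨hub, hbv⟩, hu'b⟩)).2
  obtain ⟨b, hb, b', hb', hbb⟩ := one_lt_card.1 (hcard u u' hvu hvu' hne)
  obtain ⟨c, hc, c', hc', hcc⟩ := one_lt_card.1 (hcard u' u hvu' hvu hne.symm)
  simp only [mem_sdiff, mem_erase, SimpleGraph.mem_neighborFinset] at hb hb' hc hc'
  by_contra! hcon
  have hadj : ∀ b c, ((b ≠ v ∧ Γ.Adj u b) ∧ ¬Γ.Adj u' b) →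
      ((c ≠ v ∧ Γ.Adj u' c) ∧ ¬Γ.Adj u c) → Γ.Adj b c := by
    intro b c hb hc
    by_contra hbc
    exact hcon b c hb.1.symm hc.1.symm ⟨hne, hc.2, fun h => hb.2 h.symm, hbc⟩
  have hne_u : ∀ z, Γ.Adj u' z → z ≠ u := fun z hz hzu =>
    not_adj_of_cliqueFree_three htri hvu' hvu (hzu ▸ hz)
  -- Both `b c' b' c` and `b u b' c` are 4-cycles through the edge `bc`.
  have hsq : (c', b') ∈ squares Γ b c :=
    mem_squares.2 ⟨⟨hadj b c' hb hc', hcc.symm⟩, ⟨(hadj b' c hb' hc).symm, hbb.symm⟩,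
      (hadj b' c' hb' hc').symm⟩
  have hsq' : (u, b') ∈ squares Γ b c :=
    mem_squares.2 ⟨⟨hb.1.2.symm, (hne_u c hc.1.2).symm⟩, ⟨(hadj b' c hb' hc).symm, hbb.symm⟩,
      hb'.1.2⟩
  exact hne_u c' hc'.1.2 (eq_of_mem_squares hle (hadj b c hb hc) hsq hsq').1

theorem card_neighborFinset_union_sdiff (hreg : Γ.IsRegularOfDegree 4) (hvu : Γ.Adj v u)
    (h : (y, x) ∈ squares Γ v u) :
    4 ≤ #((Γ.neighborFinset u ∪ Γ.neighborFinset y) \ {v, x}) := by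
  obtain ⟨⟨hvy, hyu⟩, -⟩ := mem_squares.1 h
  have hinter : Γ.neighborFinset u ∩ Γ.neighborFinset y ⊆ {v, x} := by
    intro z hz
    simp only [mem_inter, SimpleGraph.mem_neighborFinset] at hz
    rw [mem_insert, mem_singleton, or_iff_not_imp_left]
    exact fun hzv =>
      (eq_of_mem_squares hle hvu (mem_squares.2 ⟨⟨hvy, hyu⟩, ⟨hz.1, hzv⟩, hz.2⟩) h).2
  have hunion := card_union_add_card_inter (Γ.neighborFinset u) (Γ.neighborFinset y)
  rw [Γ.card_neighborFinset_eq_degree, Γ.card_neighborFinset_eq_degree, hreg.degree_eq,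
    hreg.degree_eq] at hunion
  have hle_two := (card_le_card hinter).trans card_le_two
  have hsdiff := le_card_sdiff {v, x} (Γ.neighborFinset u ∪ Γ.neighborFinset y)
  have := card_le_two (a := v) (b := x)
  omega

/-- The four neighbors of `u` and `y` other than `v` and `x` are not adjacent to `b`, and they
cannot all be adjacent to `c`, which has a further neighbor. -/
theorem exists_not_adj_of_adj (hreg : Γ.IsRegularOfDegree 4) (hvu : Γ.Adj v u)
    (h : (y, x) ∈ squares Γ v u) {b c j : V} (hxb : Γ.Adj x b) (hbu : b ≠ u) (hby : b ≠ y)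
    (hcj : Γ.Adj c j) (hju : ¬Γ.Adj u j) (hjy : ¬Γ.Adj y j) :
    ∃ p ≠ v, (Γ.Adj u p ∨ Γ.Adj y p) ∧ ¬Γ.Adj p b ∧ ¬Γ.Adj p c := by
  by_contra! hcon
  have hb : ∀ p, p ≠ v → p ≠ x → (Γ.Adj u p ∨ Γ.Adj y p) → ¬Γ.Adj p b := by
    rintro p hpv hpx (hup | hyp)
    · exact not_adj_of_mem_squares hle hvu h hup hpv hpx hbu hxb
    · exact not_adj_of_mem_squares hle (mem_squares.1 h).1.1 (mem_squares_swap h hvu) hyp hpv hpx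
        hby hxb
  have hsub : insert j ((Γ.neighborFinset u ∪ Γ.neighborFinset y) \ {v, x}) ⊆
      Γ.neighborFinset c := by
    intro p
    simp only [mem_insert, mem_sdiff, mem_union, SimpleGraph.mem_neighborFinset, mem_singleton,
      not_or]
    rintro (rfl | ⟨hp, hpv, hpx⟩)
    exacts [hcj, (hcon p hpv hp (hb p hpv hpx hp)).symm]
  have hcard := card_le_card hsub
  rw [card_insert_of_notMem (by simp [hju, hjy]), Γ.card_neighborFinset_eq_degree,
    hreg.degree_eq] at hcard
  have := card_neighborFinset_union_sdiff hle hreg hvu h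
  omega

theorem exists_not_adj (hreg : Γ.IsRegularOfDegree 4) (htri : Γ.CliqueFree 3) (hvu : Γ.Adj v u)
    (h : (y, x) ∈ squares Γ v u) {b c j j' : V} (hvj : Γ.Adj v j) (hvj' : Γ.Adj v j')
    (hjb : Γ.Adj j b) (hjc : Γ.Adj j' c) :
    ∃ p ≠ v, (Γ.Adj u p ∨ Γ.Adj y p) ∧ ¬Γ.Adj p b ∧ ¬Γ.Adj p c := by
  obtain ⟨⟨hvy, -⟩, ⟨hux, hxv⟩, -⟩ := mem_squares.1 h
  have hindep : ∀ {i j}, Γ.Adj v i → Γ.Adj v j → ¬Γ.Adj i j := not_adj_of_cliqueFree_three htri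
  have hne : ∀ {i j w}, Γ.Adj v i → Γ.Adj v j → Γ.Adj j w → w ≠ i := fun hi hj hw hwi =>
    hindep hj hi (hwi ▸ hw)
  by_cases hxb : Γ.Adj x b
  · exact exists_not_adj_of_adj hle hreg hvu h hxb (hne hvu hvj hjb) (hne hvy hvj hjb) hjc.symm
      (hindep hvu hvj') (hindep hvy hvj')
  by_cases hxc : Γ.Adj x c
  · obtain ⟨p, hpv, hp, hpc, hpb⟩ := exists_not_adj_of_adj hle hreg hvu h hxc (hne hvu hvj' hjc)
      (hne hvy hvj' hjc) hjb.symm (hindep hvu hvj) (hindep hvy hvj)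
    exact ⟨p, hpv, hp, hpb, hpc⟩
  exact ⟨x, hxv, Or.inl hux, hxb, hxc⟩

theorem isGoodRoot_of_mem_squares (hreg : Γ.IsRegularOfDegree 4) (htri : Γ.CliqueFree 3)
    (hvu : Γ.Adj v u) (h : (y, x) ∈ squares Γ v u) : IsGoodRoot Γ v := by
  have hvy : Γ.Adj v y := (mem_squares.1 h).1.1
  obtain ⟨j, hj, j', hj', hjj⟩ : ∃ j, (Γ.Adj v j ∧ j ≠ u ∧ j ≠ y) ∧
      ∃ j', (Γ.Adj v j' ∧ j' ≠ u ∧ j' ≠ y) ∧ j ≠ j' := by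
    have hcard := le_card_sdiff {u, y} (Γ.neighborFinset v)
    rw [Γ.card_neighborFinset_eq_degree, hreg.degree_eq] at hcard
    have := card_le_two (a := u) (b := y)
    obtain ⟨j, hj, j', hj', hjj⟩ := one_lt_card.1 (show 1 < #(Γ.neighborFinset v \ {u, y}) by omega)
    exact ⟨j, by simpa using hj, j', by simpa using hj', hjj⟩
  obtain ⟨b, c, hb, hc, hbc⟩ := exists_separated hle hreg htri hj.1 hj'.1 hjj
  have hbcv := (IsInducedMatchingAt.empty.cons hj'.1 hc.1 hc.2 finZeroElim).cons hj.1 hb.1 hb.2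
    (Fin.forall_fin_one.2 hbc)
  obtain ⟨p, hpv, hp, hpb, hpc⟩ := exists_not_adj hle hreg htri hvu h hj.1 hj'.1 hb.1 hc.1
  rcases hp with hup | hyp
  · exact isGoodRoot_of_squares_nonempty hreg (hbcv.cons hvu hup hpv (Fin.forall_fin_two.2
      ⟨separated_of_mem_squares hle hvu h hj.1 hj.2.1 hj.2.2 hup hpv hb.1 hb.2 hpb,
        separated_of_mem_squares hle hvu h hj'.1 hj'.2.1 hj'.2.2 hup hpv hc.1 hc.2 hpc⟩)) hvu h
  · have h' := mem_squares_swap h hvu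
    exact isGoodRoot_of_squares_nonempty hreg (hbcv.cons hvy hyp hpv (Fin.forall_fin_two.2
      ⟨separated_of_mem_squares hle hvy h' hj.1 hj.2.2 hj.2.1 hyp hpv hb.1 hb.2 hpb,
        separated_of_mem_squares hle hvy h' hj'.1 hj'.2.2 hj'.2.1 hyp hpv hc.1 hc.2 hpc⟩)) hvu h

end AtMostOneSquare

section NoSquare

theorem eq_of_common_neighbors {u' a a' : V} (hno : ∀ v u, Γ.Adj v u → squares Γ v u = ∅)
    (hne : u ≠ u') (hua : Γ.Adj u a) (hua' : Γ.Adj u a') (hu'a : Γ.Adj u' a) (hu'a' : Γ.Adj u' a') :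
    a = a' := by
  by_contra haa
  have h : (u', a') ∈ squares Γ a u :=
    mem_squares.2 ⟨⟨hu'a.symm, hne.symm⟩, ⟨hua', Ne.symm haa⟩, hu'a'⟩
  simp [hno a u hua.symm] at h

theorem separated_of_squares_eq_empty {u' w' : V} (hno : ∀ v u, Γ.Adj v u → squares Γ v u = ∅)
    (hvu : Γ.Adj v u) (hvu' : Γ.Adj v u') (hne : u ≠ u') (huw : Γ.Adj u w) (hwv : w ≠ v)
    (huw' : Γ.Adj u' w') (hwv' : w' ≠ v) (hww : ¬Γ.Adj w w') : Separated Γ (u, w) (u', w') :=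
  ⟨hne, fun h => hwv' (eq_of_common_neighbors hno hne h hvu.symm huw' hvu'.symm),
    fun h => hwv (eq_of_common_neighbors hno hne huw hvu.symm h.symm hvu'.symm), hww⟩

theorem isGoodRoot_of_squares_eq_empty (hreg : Γ.IsRegularOfDegree 4) (htri : Γ.CliqueFree 3)
    (hno : ∀ v u, Γ.Adj v u → squares Γ v u = ∅) (v : V) : IsGoodRoot Γ v := by
  have hcard : #(Γ.neighborFinset v) = 4 := by
    rw [Γ.card_neighborFinset_eq_degree, hreg.degree_eq]
  obtain ⟨u⟩ : Nonempty (Fin 4 ≃ Γ.neighborFinset v) := ⟨(equivFinOfCardEq hcard).symm⟩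
  have hvu : ∀ i, Γ.Adj v (u i) := fun i => (Γ.mem_neighborFinset v _).1 (u i).2
  have hu_inj : ∀ {i j}, i ≠ j → (u i : V) ≠ u j := (Subtype.val_injective.comp u.injective).ne
  have hne : ∀ {i j w}, Γ.Adj (u j) w → w ≠ u i := fun hw hwi =>
    not_adj_of_cliqueFree_three htri (hvu _) (hvu _) (hwi ▸ hw)
  obtain ⟨d, hd, hdv⟩ : ∃ d ∈ Γ.neighborFinset (u 0), d ∉ ({v} : Finset V) :=
    exists_mem_notMem_of_card_lt_card
      (by rw [Γ.card_neighborFinset_eq_degree, hreg.degree_eq]; simp)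
  rw [SimpleGraph.mem_neighborFinset] at hd
  rw [mem_singleton] at hdv
  obtain ⟨f, hf, hindep⟩ := exists_independent_transversal
    (s := fun i => (Γ.neighborFinset (u i.succ)).erase v \ Γ.neighborFinset d) htri
    (fun i => one_lt_card_neighborFinset_erase_sdiff hreg (hvu _).symm
      fun a ha _ hda b hb _ hdb => eq_of_common_neighbors hno (hne hd).symm ha hb hda hdb)
    (by
      simp only [mem_sdiff, mem_erase, SimpleGraph.mem_neighborFinset]
      exact fun i j _ a ha b hb b' hb' hab hab' =>
        eq_of_common_neighbors hno (hne ha.1.2) hab hab' hb.1.2 hb'.1.2)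
  simp only [mem_sdiff, mem_erase, SimpleGraph.mem_neighborFinset] at hf
  have hmatching : IsInducedMatchingAt Γ v fun i => ((u i.succ : V), f i) :=
    ⟨fun i => hvu _, fun i => (hf i).1.2, fun i => (hf i).1.1, fun i j hij =>
      separated_of_squares_eq_empty hno (hvu _) (hvu _) (hu_inj ((Fin.succ_injective _).ne hij))
        (hf i).1.2 (hf i).1.1 (hf j).1.2 (hf j).1.1 (hindep hij)⟩
  exact isGoodRoot_of_inducedMatching hreg (hmatching.cons (hvu 0) hd hdv fun i =>
    separated_of_squares_eq_empty hno (hvu _) (hvu _) (hu_inj (Fin.succ_ne_zero i).symm) hd hdv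
      (hf i).1.2 (hf i).1.1 (hf i).2)

end NoSquare

theorem exists_isGoodRoot [Nonempty V] (hreg : Γ.IsRegularOfDegree 4) (htri : Γ.CliqueFree 3) :
    ∃ v, IsGoodRoot Γ v := by
  by_cases hle : ∀ v u, Γ.Adj v u → #(squares Γ v u) ≤ 1
  · by_cases hno : ∀ v u, Γ.Adj v u → squares Γ v u = ∅
    · exact ⟨Classical.arbitrary V, isGoodRoot_of_squares_eq_empty hreg htri hno _⟩
    · push Not at hno
      obtain ⟨v, u, hvu, ⟨⟨y, x⟩, h⟩⟩ := hno
      exact ⟨v, isGoodRoot_of_mem_squares hle hreg htri hvu h⟩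
  · push Not at hle
    obtain ⟨v, u, hvu, h⟩ := hle
    exact exists_isGoodRoot_of_two_le_card_squares hreg htri hvu h

end GoodRoot

section Greedy

variable {β : Type*} {H : SimpleGraph β} {n : ℕ} {P : Finset β}

theorem exists_coloring_finset (hP : H.IsIndepSet P) (T : Finset β) (hTP : Disjoint T P)
    (h : ∀ S ⊆ T, S.Nonempty → ∃ e ∈ S, #{f ∈ S | H.Adj e f} + min 1 #P ≤ n) :
    ∃ c : β → Fin (n + 1), (∀ e ∈ P, c e = 0) ∧
      ∀ e ∈ T ∪ P, ∀ f ∈ T ∪ P, H.Adj e f → c e ≠ c f := by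
  induction hT : #T generalizing T with
  | zero =>
    obtain rfl := card_eq_zero.1 hT
    refine ⟨fun _ => 0, fun _ _ => rfl, fun e he f hf hef => ?_⟩
    rw [empty_union] at he hf
    exact absurd hef (hP he hf hef.ne)
  | succ m ih =>
    obtain ⟨e, heT, he⟩ := h T subset_rfl (card_pos.1 (by omega))
    obtain ⟨c, hcP, hc⟩ := ih (T.erase e) (hTP.mono_left (erase_subset e T))
      (fun S hS => h S (hS.trans (erase_subset e T))) (by rw [card_erase_of_mem heT, hT]; rfl)
    have hforbidden : #({f ∈ T | H.Adj e f}.image c ∪ P.image fun _ => 0) <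
        #(univ : Finset (Fin (n + 1))) := by
      rw [card_fin, Nat.lt_succ_iff]
      refine (card_union_le _ _).trans
        ((add_le_add card_image_le (le_min ?_ card_image_le)).trans he)
      exact card_le_one.2 (by simp +contextual)
    obtain ⟨a, -, ha⟩ := exists_mem_notMem_of_card_lt_card hforbidden
    have hne : ∀ f ∈ T ∪ P, H.Adj e f → c f ≠ a := by
      rintro f hf hef rfl
      refine ha (mem_union.2 ((mem_union.1 hf).imp (fun hfT => ?_) fun hfP => ?_))
      · exact mem_image_of_mem c (mem_filter.2 ⟨hfT, hef⟩)
      · exact mem_image.2 ⟨f, hfP, (hcP f hfP).symm⟩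
    refine ⟨Function.update c e a, fun f hf => ?_, fun f hf g hg hfg => ?_⟩
    · rw [Function.update_of_ne (by rintro rfl; exact disjoint_left.1 hTP heT hf), hcP f hf]
    · rcases eq_or_ne f e with rfl | hfe
      · rw [Function.update_self, Function.update_of_ne hfg.ne']
        exact (hne g hg hfg).symm
      rcases eq_or_ne g e with rfl | hge
      · rw [Function.update_self, Function.update_of_ne hfe]
        exact hne f hf hfg.symm
      · rw [Function.update_of_ne hfe, Function.update_of_ne hge]
        simp only [mem_union, mem_erase] at hf hg hc
        exact hc f (hf.imp_left (And.intro hfe)) g (hg.imp_left (And.intro hge)) hfg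

theorem colorable_induce_of_forall_finset (A : Set β) (hP : H.IsIndepSet P)
    (h : ∀ S : Finset β, ↑S ⊆ A → Disjoint S P → S.Nonempty →
      ∃ e ∈ S, #{f ∈ S | H.Adj e f} + min 1 #P ≤ n) :
    (H.induce A).Colorable (n + 1) := by
  refine SimpleGraph.nonempty_hom_of_forall_finite_subgraph_hom fun G' hG' => Nonempty.some ?_
  have hT : ∀ e ∈ (hG'.image Subtype.val).toFinset, e ∈ A := by
    simp +contextual
  obtain ⟨c, -, hc⟩ := exists_coloring_finset (n := n) hP ((hG'.image Subtype.val).toFinset \ P)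
    sdiff_disjoint fun S hS =>
      h S (fun e he => hT e (mem_sdiff.1 (hS he)).1) (sdiff_disjoint.mono_left hS)
  rw [sdiff_union_self_eq_union] at hc
  have hmem : ∀ e : G'.verts, (e.1.1 : β) ∈ (hG'.image Subtype.val).toFinset ∪ P := fun e =>
    mem_union_left _ ((hG'.image _).mem_toFinset.2 (Set.mem_image_of_mem _ e.2))
  exact ⟨⟨fun e => c e.1.1, fun {e f} hef => hc _ (hmem e) _ (hmem f) hef.adj_sub⟩⟩

end Greedy

section Square

variable {β : Type*} {L : SimpleGraph β} {e f g : β}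

/-- The square of a simple graph: distinct vertices are adjacent when their distance is at most
two. -/
def square (L : SimpleGraph β) : SimpleGraph β where
  Adj e f := e ≠ f ∧ (L.Adj e f ∨ ∃ g, L.Adj e g ∧ L.Adj g f)
  symm := ⟨fun _ _ ⟨hne, h⟩ => ⟨hne.symm,
    h.imp SimpleGraph.Adj.symm fun ⟨g, heg, hgf⟩ => ⟨g, hgf.symm, heg.symm⟩⟩⟩
  loopless := ⟨fun _ h => h.1 rfl⟩

theorem reachable_of_reachable_square (h : (square L).Reachable e f) : L.Reachable e f := by
  rw [SimpleGraph.reachable_iff_reflTransGen] at h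
  induction h with
  | refl => rfl
  | tail _ hfg ih =>
    obtain ⟨-, hfg | ⟨g, hfg, hgh⟩⟩ := hfg
    exacts [ih.trans hfg.reachable, ih.trans (hfg.reachable.trans hgh.reachable)]

variable [L.LocallyFinite]

/-- The vertices at distance two from `e` that are reached through its neighbor `g`. -/
def far (L : SimpleGraph β) [L.LocallyFinite] (e g : β) : Finset β :=
  L.neighborFinset g \ insert e (L.neighborFinset e)

theorem mem_far : f ∈ far L e g ↔ L.Adj g f ∧ f ≠ e ∧ ¬L.Adj e f := by
  simp only [far, mem_sdiff, SimpleGraph.mem_neighborFinset, mem_insert, not_or]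

theorem adj_square_iff : (square L).Adj e f ↔
    L.Adj e f ∨ ∃ g ∈ L.neighborFinset e, f ∈ far L e g := by
  simp only [SimpleGraph.mem_neighborFinset, mem_far]
  constructor
  · rintro ⟨hne, h⟩
    by_cases hef : L.Adj e f
    · exact .inl hef
    · exact .inr ((h.resolve_left hef).imp fun g hg => ⟨hg.1, hg.2, hne.symm, hef⟩)
  · rintro (hef | ⟨g, heg, hgf, hne, -⟩)
    exacts [⟨hef.ne, .inl hef⟩, ⟨hne.symm, .inr ⟨g, heg, hgf⟩⟩]

instance : (square L).LocallyFinite := fun e =>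
  Fintype.ofFinset (L.neighborFinset e ∪ (L.neighborFinset e).biUnion (far L e)) fun f => by
    rw [SimpleGraph.mem_neighborSet, adj_square_iff, mem_union, mem_biUnion,
      SimpleGraph.mem_neighborFinset]

theorem neighborFinset_square (e : β) : (square L).neighborFinset e =
    L.neighborFinset e ∪ (L.neighborFinset e).biUnion (far L e) := by
  ext f
  rw [SimpleGraph.mem_neighborFinset, adj_square_iff, mem_union, mem_biUnion,
    SimpleGraph.mem_neighborFinset]

theorem card_biUnion_add_card_le {ι : Type*} {B : Finset ι} {t : ι → Finset β} {D : Finset β}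
    (hD : ∀ x ∈ D, ∃ i ∈ B, ∃ j ∈ B, i ≠ j ∧ x ∈ t i ∧ x ∈ t j) :
    #(B.biUnion t) + #D ≤ ∑ i ∈ B, #(t i) := by
  have hmult : ∀ x ∈ B.biUnion t, 1 + (if x ∈ D then 1 else 0) ≤ #{i ∈ B | x ∈ t i} := by
    intro x hx
    split_ifs with hxD
    · obtain ⟨i, hi, j, hj, hij, hxi, hxj⟩ := hD x hxD
      exact one_lt_card.2 ⟨i, mem_filter.2 ⟨hi, hxi⟩, j, mem_filter.2 ⟨hj, hxj⟩, hij⟩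
    · obtain ⟨i, hi, hxi⟩ := mem_biUnion.1 hx
      exact card_pos.2 ⟨i, mem_filter.2 ⟨hi, hxi⟩⟩
  have hDB : D ⊆ B.biUnion t := fun x hx =>
    let ⟨i, hi, _, _, _, hxi, _⟩ := hD x hx
    mem_biUnion.2 ⟨i, hi, hxi⟩
  calc #(B.biUnion t) + #D = ∑ x ∈ B.biUnion t, (1 + if x ∈ D then 1 else 0) := by
        rw [sum_add_distrib, sum_boole, filter_mem_eq_inter, inter_eq_right.2 hDB]
        simp
    _ ≤ ∑ x ∈ B.biUnion t, #{i ∈ B | x ∈ t i} := sum_le_sum hmult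
    _ = ∑ i ∈ B, #{x ∈ B.biUnion t | x ∈ t i} :=
        (sum_card_bipartiteAbove_eq_sum_card_bipartiteBelow fun i x => x ∈ t i).symm
    _ = ∑ i ∈ B, #(t i) := sum_congr rfl fun i hi => by
        rw [filter_mem_eq_inter, inter_eq_right.2 (subset_biUnion_of_mem t hi)]

variable {k : ℕ}

theorem degree_square_add_card_le {B D : Finset β}
    (hfar : ∀ g ∈ L.neighborFinset e, #(far L e g) ≤ k) (hB : B ⊆ L.neighborFinset e)
    (hcover : ∀ g ∈ L.neighborFinset e, ∃ g' ∈ B, far L e g ⊆ far L e g')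
    (hD : ∀ f ∈ D, ∃ g ∈ B, ∃ g' ∈ B, g ≠ g' ∧ f ∈ far L e g ∧ f ∈ far L e g') :
    (square L).degree e + #D ≤ L.degree e + #B * k := by
  have hbiUnion : (L.neighborFinset e).biUnion (far L e) ⊆ B.biUnion (far L e) := by
    refine biUnion_subset.2 fun g hg => ?_
    obtain ⟨g', hg', hsub⟩ := hcover g hg
    exact hsub.trans (subset_biUnion_of_mem _ hg')
  calc (square L).degree e + #D
      ≤ L.degree e + #(B.biUnion (far L e)) + #D := by
        rw [← SimpleGraph.card_neighborFinset_eq_degree, neighborFinset_square,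
          ← SimpleGraph.card_neighborFinset_eq_degree]
        grw [card_union_le, hbiUnion]
    _ ≤ L.degree e + ∑ g ∈ B, #(far L e g) := by
        grw [add_assoc, card_biUnion_add_card_le hD]
    _ ≤ L.degree e + #B * k := by
        grw [sum_le_card_nsmul B _ k fun g hg => hfar g (hB hg), smul_eq_mul]

theorem degree_square_add_card_le_mul {D : Finset β}
    (hfar : ∀ g ∈ L.neighborFinset e, #(far L e g) ≤ k)
    (hD : ∀ f ∈ D, ∃ g, L.Adj e g ∧ ∃ g', L.Adj e g' ∧ g ≠ g' ∧ f ∈ far L e g ∧ f ∈ far L e g') :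
    (square L).degree e + #D ≤ L.degree e * (k + 1) := by
  have := degree_square_add_card_le hfar subset_rfl (fun g hg => ⟨g, hg, subset_rfl⟩)
    (by simpa only [SimpleGraph.mem_neighborFinset] using hD)
  rwa [SimpleGraph.card_neighborFinset_eq_degree, add_comm, add_comm (L.degree e),
    ← Nat.mul_succ, add_comm] at this

theorem degree_square_add_le_of_far_subset (hfar : ∀ g ∈ L.neighborFinset e, #(far L e g) ≤ k)
    {g g' : β} (hg : L.Adj e g) (hg' : L.Adj e g') (hne : g ≠ g') (hsub : far L e g ⊆ far L e g') :
    (square L).degree e + k ≤ L.degree e * (k + 1) := by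
  have hcover : ∀ i ∈ L.neighborFinset e, ∃ j ∈ (L.neighborFinset e).erase g,
      far L e i ⊆ far L e j := by
    intro i hi
    rcases eq_or_ne i g with rfl | hig
    · exact ⟨g', mem_erase.2 ⟨hne.symm, by simpa using hg'⟩, hsub⟩
    · exact ⟨i, mem_erase.2 ⟨hig, hi⟩, subset_rfl⟩
  have := degree_square_add_card_le hfar (erase_subset g _) hcover (D := ∅) (by simp)
  have herase := card_erase_add_one ((L.mem_neighborFinset e g).2 hg)
  rw [SimpleGraph.card_neighborFinset_eq_degree] at herase
  rw [card_empty] at this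
  nlinarith

theorem card_filter_adj_square_add_le (hfar : ∀ g ∈ L.neighborFinset e, #(far L e g) ≤ k)
    {S : Finset β} (hg : L.Adj e g) (hgS : g ∉ S) (hS : Disjoint S (far L e g)) :
    #{f ∈ S | (square L).Adj e f} + (k + 1) ≤ L.degree e * (k + 1) := by
  have hsub : {f ∈ S | (square L).Adj e f} ⊆
      (L.neighborFinset e).erase g ∪ ((L.neighborFinset e).erase g).biUnion (far L e) := by
    intro f hf
    obtain ⟨hfS, hef⟩ := mem_filter.1 hf
    simp only [mem_union, mem_erase, mem_biUnion]
    rcases adj_square_iff.1 hef with hef | ⟨g', hg', hfg'⟩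
    · exact .inl ⟨ne_of_mem_of_not_mem hfS hgS, by simpa using hef⟩
    · refine .inr ⟨g', ⟨?_, hg'⟩, hfg'⟩
      rintro rfl
      exact disjoint_left.1 hS hfS hfg'
  have hle : #{f ∈ S | (square L).Adj e f} ≤ #((L.neighborFinset e).erase g) * (k + 1) := by
    grw [hsub, card_union_le,
      card_biUnion_le_card_mul _ _ k fun g hg => hfar g (mem_of_mem_erase hg)]
    rw [Nat.mul_succ, add_comm]
  have herase := card_erase_add_one ((L.mem_neighborFinset e g).2 hg)
  rw [SimpleGraph.card_neighborFinset_eq_degree] at herase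
  nlinarith

end Square

section LineGraph

variable {α β : Type*} {G : Graph α β} {e e' f g : β} {v w x y : α} {k : ℕ}

/-- The line graph of a multigraph, on the type of all labels: the labels that are not edges are
isolated. -/
def lineGraph (G : Graph α β) : SimpleGraph β where
  Adj e f := e ≠ f ∧ ∃ x, G.Inc e x ∧ G.Inc f x
  symm := ⟨fun _ _ ⟨hne, x, he, hf⟩ => ⟨hne.symm, x, hf, he⟩⟩
  loopless := ⟨fun _ h => h.1 rfl⟩

theorem lineGraph_adj_of_inc (he : G.Inc e x) (hf : G.Inc f x) (hne : e ≠ f) :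
    (lineGraph G).Adj e f :=
  ⟨hne, x, he, hf⟩

/-- The graph whose proper colorings are the strong edge-colorings of `G`. -/
abbrev conflictGraph (G : Graph α β) : SimpleGraph β := square (lineGraph G)

theorem conflictGraph_adj_of_inc (he : G.Inc e x) (hf : G.Inc f x) (hne : e ≠ f) :
    (conflictGraph G).Adj e f :=
  ⟨hne, .inl (lineGraph_adj_of_inc he hf hne)⟩

theorem isLink_of_inc_of_inc (hx : G.Inc e x) (hy : G.Inc e y) (hxy : x ≠ y) : G.IsLink e x y := by
  obtain ⟨z, hz⟩ := hx
  rwa [hy.eq_of_isLink_of_ne_left hz hxy.symm]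

theorem conflictGraph_adj_iff : (conflictGraph G).Adj e f ↔
    e ≠ f ∧ ∃ x y, G.Inc e x ∧ G.Inc f y ∧ (x = y ∨ G.Adj x y) := by
  constructor
  · rintro ⟨hne, ⟨-, x, hex, hfx⟩ | ⟨g, ⟨-, x, hex, hgx⟩, -, y, hgy, hfy⟩⟩
    · exact ⟨hne, x, x, hex, hfx, .inl rfl⟩
    · refine ⟨hne, x, y, hex, hfy, or_iff_not_imp_left.2 fun hxy => ?_⟩
      exact ⟨g, isLink_of_inc_of_inc hgx hgy hxy⟩
  · rintro ⟨hne, x, y, hex, hfy, rfl | ⟨g, hg⟩⟩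
    · exact conflictGraph_adj_of_inc hex hfy hne
    rcases eq_or_ne e g with rfl | heg
    · exact conflictGraph_adj_of_inc hg.inc_right hfy hne
    rcases eq_or_ne g f with rfl | hgf
    · exact conflictGraph_adj_of_inc hex hg.inc_left hne
    exact ⟨hne, .inr ⟨g, lineGraph_adj_of_inc hex hg.inc_left heg,
      lineGraph_adj_of_inc hg.inc_right hfy hgf⟩⟩

theorem isStrongEdgeColoring_of_coloring {C : Type*} (c : (conflictGraph G).Coloring C) :
    G.IsStrongEdgeColoring c where
  proper _ _ _ he hf hne := c.valid (conflictGraph_adj_of_inc he hf hne)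
  ne_of_path _ g _ _ x y _ he hg hf hne :=
    c.valid (conflictGraph_adj_iff.2 ⟨hne, x, y, he.inc_right, hf.inc_left, .inr ⟨g, hg⟩⟩)

theorem reachable_toSimpleGraph_of_inc {x y : G.vertexSet} (hx : G.Inc e x) (hy : G.Inc e y) :
    G.toSimpleGraph.Reachable x y := by
  obtain ⟨z, hz⟩ := hx
  rcases hy.eq_or_eq_of_isLink hz with hyx | rfl
  · rw [Subtype.ext hyx]
  rcases eq_or_ne x y with rfl | hxy
  · rfl
  · exact SimpleGraph.Adj.reachable ⟨hxy, hz.adj⟩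

theorem exists_inc_reachable_of_reachable (hef : (conflictGraph G).Reachable e f)
    {x : G.vertexSet} (hx : G.Inc e x) :
    ∃ y : G.vertexSet, G.Inc f y ∧ G.toSimpleGraph.Reachable x y := by
  replace hef := reachable_of_reachable_square hef
  rw [SimpleGraph.reachable_iff_reflTransGen] at hef
  induction hef with
  | refl => exact ⟨x, hx, .refl x⟩
  | tail _ hfg ih =>
    obtain ⟨y, hfy, hxy⟩ := ih
    obtain ⟨-, z, hfz, hgz⟩ := hfg
    exact ⟨⟨z, hfz.vertex_mem⟩, hgz, hxy.trans (reachable_toSimpleGraph_of_inc hfy hfz)⟩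

theorem exists_isLink_forall_not_inc {T : Finset β} {v x : G.vertexSet}
    (hvx : G.toSimpleGraph.Reachable v x) (he : e ∈ T) (hex : G.Inc e x)
    (hv : ∀ f ∈ T, ¬G.Inc f v) :
    ∃ f ∈ T, ∃ g a p, G.Inc f a ∧ G.IsLink g a p ∧ ∀ f' ∈ T, ¬G.Inc f' p := by
  obtain ⟨d, -, hfst, hsnd⟩ := hvx.some.exists_boundary_dart {y | ∀ f ∈ T, ¬G.Inc f y} hv
    fun hx => hx e he hex
  obtain ⟨f, hf, hfd⟩ : ∃ f ∈ T, G.Inc f d.snd := by simpa using hsnd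
  obtain ⟨-, g, hg⟩ := d.adj
  exact ⟨f, hf, g, d.snd, d.fst, hfd, hg.symm, hfst⟩

variable [∀ x, Finite (G.incidenceSet x)]

/-- The edges incident to `x`. -/
def incidenceFinset (G : Graph α β) [∀ x, Finite (G.incidenceSet x)] (x : α) : Finset β :=
  (G.incidenceSet x).toFinite.toFinset

@[simp]
theorem mem_incidenceFinset : e ∈ incidenceFinset G x ↔ G.Inc e x := by
  simp [incidenceFinset]

theorem neighborSet_lineGraph_subset (he : G.IsLink e x y) : (lineGraph G).neighborSet e ⊆
    ↑((incidenceFinset G x).erase e ∪ (incidenceFinset G y).erase e) := by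
  rintro f ⟨hne, z, hez, hfz⟩
  simp only [coe_union, coe_erase, Set.mem_union, Set.mem_sdiff, mem_coe, mem_incidenceFinset,
    Set.mem_singleton_iff]
  rcases hez.eq_or_eq_of_isLink he with rfl | rfl
  exacts [.inl ⟨hfz, hne.symm⟩, .inr ⟨hfz, hne.symm⟩]

instance : (lineGraph G).LocallyFinite := fun e => by
  refine @Fintype.ofFinite _ (Set.Finite.to_subtype ?_)
  by_cases he : ∃ x y, G.IsLink e x y
  · obtain ⟨x, y, he⟩ := he
    exact (finite_toSet _).subset (neighborSet_lineGraph_subset he)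
  · have hempty : (lineGraph G).neighborSet e = ∅ :=
      Set.eq_empty_of_forall_notMem fun _ ⟨_, x, hex, _⟩ => he ⟨x, hex⟩
    exact hempty ▸ Set.finite_empty

theorem neighborFinset_lineGraph_subset (he : G.IsLink e x y) : (lineGraph G).neighborFinset e ⊆
    (incidenceFinset G x).erase e ∪ (incidenceFinset G y).erase e := by
  rw [← coe_subset, SimpleGraph.coe_neighborFinset]
  exact neighborSet_lineGraph_subset he

theorem inc_of_mem_far (hex : G.Inc e x) (hg : G.IsLink g x y) (hf : f ∈ far (lineGraph G) e g) :
    G.Inc f y := by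
  obtain ⟨⟨-, z, hgz, hfz⟩, hfe, hef⟩ := mem_far.1 hf
  rcases hgz.eq_or_eq_of_isLink hg with rfl | rfl
  exacts [absurd (lineGraph_adj_of_inc hex hfz hfe.symm) hef, hfz]

theorem far_lineGraph_subset (hex : G.Inc e x) (hg : G.IsLink g x y) :
    far (lineGraph G) e g ⊆ (incidenceFinset G y).erase g := fun _ hf =>
  mem_erase.2 ⟨(mem_far.1 hf).1.ne', mem_incidenceFinset.2 (inc_of_mem_far hex hg hf)⟩

section BoundedDegree

variable (hk : ∀ x, #(incidenceFinset G x) ≤ k + 1)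
include hk

theorem card_incidenceFinset_erase_le (he : G.Inc e x) : #((incidenceFinset G x).erase e) ≤ k := by
  rw [card_erase_of_mem (mem_incidenceFinset.2 he)]
  exact Nat.sub_le_of_le_add (hk x)

theorem card_far_lineGraph_le (hg : g ∈ (lineGraph G).neighborFinset e) :
    #(far (lineGraph G) e g) ≤ k := by
  obtain ⟨-, x, hex, y, hg⟩ := (SimpleGraph.mem_neighborFinset ..).1 hg
  exact (card_le_card (far_lineGraph_subset hex hg)).trans
    (card_incidenceFinset_erase_le hk hg.inc_right)

theorem degree_lineGraph_lt (he : G.IsLink e x y) :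
    (lineGraph G).degree e < #(incidenceFinset G x) + k := by
  have hx := card_erase_add_one (mem_incidenceFinset.2 he.inc_left)
  have hsub := card_le_card (neighborFinset_lineGraph_subset he)
  grw [card_union_le, card_incidenceFinset_erase_le hk he.inc_right] at hsub
  rw [SimpleGraph.card_neighborFinset_eq_degree] at hsub
  omega

theorem degree_lineGraph_le (e : β) : (lineGraph G).degree e ≤ 2 * k := by
  by_cases he : ∃ x y, G.IsLink e x y
  · obtain ⟨x, y, he⟩ := he
    have := degree_lineGraph_lt hk he
    have := hk x
    omega
  · rw [← SimpleGraph.card_neighborFinset_eq_degree, card_eq_zero.2]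
    · exact Nat.zero_le _
    · exact eq_empty_of_forall_notMem fun _ hf =>
        let ⟨_, x, hex, _⟩ := (SimpleGraph.mem_neighborFinset ..).1 hf
        he ⟨x, hex⟩

theorem degree_lineGraph_lt_of_parallel (he : G.IsLink e x y) (he' : G.IsLink e' x y)
    (hne : e ≠ e') : (lineGraph G).degree e < 2 * k := by
  have hx := card_incidenceFinset_erase_le hk he.inc_left
  have hy := card_incidenceFinset_erase_le hk he.inc_right
  have hinter : 0 < #((incidenceFinset G x).erase e ∩ (incidenceFinset G y).erase e) :=
    card_pos.2 ⟨e', by simp [hne.symm, he'.inc_left, he'.inc_right]⟩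
  have hsum := card_union_add_card_inter ((incidenceFinset G x).erase e)
    ((incidenceFinset G y).erase e)
  have hsub := card_le_card (neighborFinset_lineGraph_subset he)
  rw [SimpleGraph.card_neighborFinset_eq_degree] at hsub
  omega

end BoundedDegree

end LineGraph

section Root

variable {α β : Type*} {G : Graph α β} [∀ x, Finite (G.incidenceSet x)] {k n : ℕ}

/-- A vertex toward which the edges of its component can be colored greedily with `n + 1` colors:
some set `P` of edges off `v` may share a color, and this leaves room to color the edges at `v`
last, one after the other. In the condition `S` is the set of the edges at `v` up to `e` in this
order, so that the conflicts of `e` with the edges outside `S` are harmless. -/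
def IsRoot (G : Graph α β) [∀ x, Finite (G.incidenceSet x)] (n : ℕ) (v : α) : Prop :=
  ∃ P : Finset β, (conflictGraph G).IsIndepSet P ∧ Disjoint P (incidenceFinset G v) ∧
    ∀ S ⊆ incidenceFinset G v, S.Nonempty → ∃ e ∈ S,
      #((conflictGraph G).neighborFinset e \ P) + min 1 #P ≤ n + #(incidenceFinset G v \ S)

theorem card_filter_conflictGraph_adj_le (hk : ∀ x, #(incidenceFinset G x) ≤ k + 1) {T : Finset β}
    {e g : β} {x y : α} (he : e ∈ T) (hex : G.Inc e x) (hg : G.IsLink g x y)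
    (hy : ∀ f ∈ T, ¬G.Inc f y) :
    #{f ∈ T | (conflictGraph G).Adj e f} + (k + 1) ≤ 2 * k * (k + 1) := by
  have hgT : g ∉ T := fun hgT => hy g hgT hg.inc_right
  have hfar : Disjoint T (far (lineGraph G) e g) :=
    disjoint_left.2 fun f hfT hf => hy f hfT (inc_of_mem_far hex hg hf)
  have heg := lineGraph_adj_of_inc hex hg.inc_left (ne_of_mem_of_not_mem he hgT)
  grw [← degree_lineGraph_le hk e]
  exact card_filter_adj_square_add_le (fun _ => card_far_lineGraph_le hk) heg hgT hfar

theorem colorable_induce_of_isRoot (hk : ∀ x, #(incidenceFinset G x) ≤ k + 1)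
    (hn : 2 * k * (k + 1) ≤ n + k) {v : G.vertexSet} (hv : IsRoot G n v) {A : Set β}
    (hA : ∀ e ∈ A, ∃ x : G.vertexSet, G.Inc e x ∧ G.toSimpleGraph.Reachable v x) :
    ((conflictGraph G).induce A).Colorable (n + 1) := by
  obtain ⟨P, hP, hPv, hroot⟩ := hv
  refine colorable_induce_of_forall_finset A hP fun T hTA hTP hT => ?_
  by_cases hTv : (T ∩ incidenceFinset G v).Nonempty
  · obtain ⟨e, he, hle⟩ := hroot _ inter_subset_right hTv
    obtain ⟨heT, hev⟩ := mem_inter.1 he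
    refine ⟨e, heT, ?_⟩
    rw [sdiff_inter_self_right] at hle
    have hdisj : Disjoint {f ∈ T | (conflictGraph G).Adj e f} (incidenceFinset G v \ T) :=
      disjoint_sdiff.mono_left (filter_subset _ T)
    have hsub : {f ∈ T | (conflictGraph G).Adj e f} ∪ incidenceFinset G v \ T ⊆
        (conflictGraph G).neighborFinset e \ P := by
      intro f hf
      rw [mem_sdiff, SimpleGraph.mem_neighborFinset]
      rcases mem_union.1 hf with hf | hf
      · obtain ⟨hfT, hef⟩ := mem_filter.1 hf
        exact ⟨hef, disjoint_left.1 hTP hfT⟩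
      · obtain ⟨hfv, hfT⟩ := mem_sdiff.1 hf
        exact ⟨conflictGraph_adj_of_inc (mem_incidenceFinset.1 hev) (mem_incidenceFinset.1 hfv)
          (ne_of_mem_of_not_mem heT hfT), disjoint_right.1 hPv hfv⟩
    have hcard := card_le_card hsub
    rw [card_union_of_disjoint hdisj] at hcard
    omega
  · obtain ⟨e, he⟩ := hT
    obtain ⟨x, hex, hvx⟩ := hA e (hTA he)
    obtain ⟨f, hf, g, a, p, hfa, hg, hp⟩ := exists_isLink_forall_not_inc hvx he hex
      fun f hfT hfv => hTv ⟨f, mem_inter.2 ⟨hfT, mem_incidenceFinset.2 hfv⟩⟩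
    have := card_filter_conflictGraph_adj_le hk hf hfa hg hp
    exact ⟨f, hf, by omega⟩

theorem conflictGraph_colorable (hk : ∀ x, #(incidenceFinset G x) ≤ k + 1)
    (hn : 2 * k * (k + 1) ≤ n + k)
    (hroot : ∀ C : G.toSimpleGraph.ConnectedComponent, ∃ v ∈ C.supp, IsRoot G n v) :
    (conflictGraph G).Colorable (n + 1) := by
  refine SimpleGraph.colorable_iff_forall_connectedComponent.2 fun C => ?_
  by_cases hC : ∃ e ∈ C.supp, ∃ x, G.Inc e x
  · obtain ⟨e, rfl, x, hex⟩ := hC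
    obtain ⟨v, hvx, hv⟩ := hroot (G.toSimpleGraph.connectedComponentMk ⟨x, hex.vertex_mem⟩)
    refine colorable_induce_of_isRoot hk hn hv fun f hf => ?_
    obtain ⟨y, hfy, hxy⟩ :=
      exists_inc_reachable_of_reachable (SimpleGraph.ConnectedComponent.exact hf).symm
        (x := ⟨x, hex.vertex_mem⟩) hex
    exact ⟨y, hfy, (SimpleGraph.ConnectedComponent.exact hvx).trans hxy⟩
  · refine ⟨⟨fun _ => 0, fun {e f} hef => ?_⟩⟩
    obtain ⟨-, ⟨-, x, hx, -⟩ | ⟨g, ⟨-, x, hx, -⟩, -⟩⟩ := hef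
    exacts [absurd ⟨e, e.2, x, hx⟩ hC, absurd ⟨e, e.2, x, hx⟩ hC]

end Root

section RootCriteria

variable {α β : Type*} {G : Graph α β} [∀ x, Finite (G.incidenceSet x)] {k n : ℕ}
  {e e' f g g' : β} {u v x y z : α}

theorem isRoot_of_degree_le (h : ∀ S ⊆ incidenceFinset G v, S.Nonempty →
    ∃ e ∈ S, (conflictGraph G).degree e ≤ n + #(incidenceFinset G v \ S)) : IsRoot G n v :=
  ⟨∅, by simp, disjoint_empty_left _, by simpa using h⟩

theorem isRoot_of_forall_degree_le (h : ∀ e, G.Inc e v → (conflictGraph G).degree e ≤ n) :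
    IsRoot G n v :=
  isRoot_of_degree_le fun _ hS ⟨e, he⟩ =>
    ⟨e, he, (h e (mem_incidenceFinset.1 (hS he))).trans (Nat.le_add_right ..)⟩

theorem far_subset_far_of_inc (hex : G.Inc e x) (hg : G.IsLink g x y) (hg' : G.Inc g' y)
    (heg' : (lineGraph G).Adj e g') : far (lineGraph G) e g ⊆ far (lineGraph G) e g' := by
  intro f hf
  obtain ⟨-, hfe, hef⟩ := mem_far.1 hf
  have hne : g' ≠ f := by
    rintro rfl
    exact hef heg'
  exact mem_far.2 ⟨lineGraph_adj_of_inc hg' (inc_of_mem_far hex hg hf) hne, hfe, hef⟩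

section BoundedDegree

variable (hk : ∀ x, #(incidenceFinset G x) ≤ k + 1)
include hk

theorem degree_conflictGraph_add_card_le {D : Finset β}
    (hD : ∀ f ∈ D, ∃ g, (lineGraph G).Adj e g ∧ ∃ g', (lineGraph G).Adj e g' ∧ g ≠ g' ∧
      f ∈ far (lineGraph G) e g ∧ f ∈ far (lineGraph G) e g') :
    (conflictGraph G).degree e + #D ≤ 2 * k * (k + 1) :=
  (degree_square_add_card_le_mul (fun _ => card_far_lineGraph_le hk) hD).trans
    (Nat.mul_le_mul_right _ (degree_lineGraph_le hk e))

theorem degree_conflictGraph_le (e : β) : (conflictGraph G).degree e ≤ 2 * k * (k + 1) :=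
  degree_conflictGraph_add_card_le (D := ∅) hk (by simp)

theorem degree_conflictGraph_lt_of_common_neighbors (hfe : (lineGraph G).Adj f e)
    (hfe' : (lineGraph G).Adj f e') (hne : e ≠ e') (heg : (lineGraph G).Adj e g)
    (heg' : (lineGraph G).Adj e' g) (hgf : g ≠ f) (hfg : ¬(lineGraph G).Adj f g) :
    (conflictGraph G).degree f < 2 * k * (k + 1) :=
  degree_conflictGraph_add_card_le (D := {g}) hk fun _ hg' => by
    rw [mem_singleton.1 hg']
    exact ⟨e, hfe, e', hfe', hne, mem_far.2 ⟨heg, hgf, hfg⟩, mem_far.2 ⟨heg', hgf, hfg⟩⟩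

theorem degree_conflictGraph_add_le (hex : G.Inc e x) (hg : G.IsLink g x y) (hg' : G.Inc g' y)
    (heg : (lineGraph G).Adj e g) (heg' : (lineGraph G).Adj e g') (hne : g ≠ g') :
    (conflictGraph G).degree e + k ≤ 2 * k * (k + 1) :=
  (degree_square_add_le_of_far_subset (fun _ => card_far_lineGraph_le hk) heg heg' hne
    (far_subset_far_of_inc hex hg hg' heg')).trans
    (Nat.mul_le_mul_right _ (degree_lineGraph_le hk e))

theorem degree_conflictGraph_add_succ_le (he : (lineGraph G).degree e < 2 * k) :
    (conflictGraph G).degree e + (k + 1) ≤ 2 * k * (k + 1) := by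
  have h := degree_square_add_card_le_mul (D := ∅) (e := e)
    (fun _ => card_far_lineGraph_le hk) (by simp)
  grw [card_empty, add_zero] at h
  grw [h, ← Nat.succ_mul, Nat.succ_le_of_lt he]

theorem isRoot_of_card_incidenceFinset_le (hn : 2 * k * (k + 1) ≤ n + k)
    (hv : #(incidenceFinset G v) ≤ k) : IsRoot G n v :=
  isRoot_of_forall_degree_le fun e ⟨_, he⟩ => by
    have hlt := degree_lineGraph_lt hk he
    have := degree_conflictGraph_add_succ_le hk (e := e) (by omega)
    omega

theorem isRoot_of_parallel (hn : 2 * k * (k + 1) ≤ n + k) (he : G.IsLink e v u)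
    (he' : G.IsLink e' v u) (hne : e ≠ e') : IsRoot G n v := by
  refine isRoot_of_forall_degree_le fun f hf => ?_
  rcases eq_or_ne f e with rfl | hfe
  · have := degree_conflictGraph_add_succ_le hk (degree_lineGraph_lt_of_parallel hk he he' hne)
    omega
  rcases eq_or_ne f e' with rfl | hfe'
  · have := degree_conflictGraph_add_succ_le hk
      (degree_lineGraph_lt_of_parallel hk he' he hne.symm)
    omega
  · have := degree_conflictGraph_add_le hk hf he he'.inc_right
      (lineGraph_adj_of_inc hf he.inc_left hfe) (lineGraph_adj_of_inc hf he'.inc_left hfe') hne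
    omega

theorem isRoot_of_embedding (hn : 2 * k * (k + 1) ≤ n + k) {P : Finset β}
    (hP : (conflictGraph G).IsIndepSet P) (hPv : Disjoint P (incidenceFinset G v))
    (hPadj : ∀ e, G.Inc e v → P ⊆ (conflictGraph G).neighborFinset e) (e : Fin k ↪ β)
    (hev : ∀ i, G.Inc (e i) v)
    (hdeg : ∀ i, (conflictGraph G).degree (e i) + k ≤ 2 * k * (k + 1) + (#P - 1) + i) :
    IsRoot G n v := by
  refine ⟨P, hP, hPv, fun S hS ⟨f, hf⟩ => ?_⟩
  have hsdiff : ∀ a, G.Inc a v →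
      #((conflictGraph G).neighborFinset a \ P) + #P = (conflictGraph G).degree a := by
    intro a ha
    rw [card_sdiff_add_card_eq_card (hPadj a ha), SimpleGraph.card_neighborFinset_eq_degree]
  obtain hm | hm := le_or_gt k #(incidenceFinset G v \ S)
  · have := hsdiff f (mem_incidenceFinset.1 (hS hf))
    have := degree_conflictGraph_le hk f
    exact ⟨f, hf, by omega⟩
  · -- If `m` edges at `v` lie outside `S`, then one of `e 0, …, e m` lies in `S`.
    have hcard : #(incidenceFinset G v \ S) < #((Iic (⟨_, hm⟩ : Fin k)).map e) := by
      rw [card_map, Fin.card_Iic]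
      exact Nat.lt_succ_self _
    obtain ⟨_, hmem, hnotMem⟩ := exists_mem_notMem_of_card_lt_card hcard
    obtain ⟨i, hi, rfl⟩ := mem_map.1 hmem
    have hi : (i : ℕ) ≤ #(incidenceFinset G v \ S) := Fin.le_def.1 (mem_Iic.1 hi)
    have hiS : e i ∈ S := by
      by_contra hiS
      exact hnotMem (mem_sdiff.2 ⟨mem_incidenceFinset.2 (hev i), hiS⟩)
    have := hsdiff (e i) (hev i)
    have := hdeg i
    exact ⟨e i, hiS, by omega⟩

end BoundedDegree

theorem isRoot_of_triangle (hk : ∀ x, #(incidenceFinset G x) ≤ 4) (he : G.IsLink e v y)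
    (he' : G.IsLink e' v z) (hg : G.IsLink g y z) (hvy : v ≠ y) (hvz : v ≠ z) (hyz : y ≠ z) :
    IsRoot G 21 v := by
  by_cases hpar : ∃ a b w, a ≠ b ∧ G.IsLink a v w ∧ G.IsLink b v w
  · obtain ⟨a, b, w, hab, ha, hb⟩ := hpar
    exact isRoot_of_parallel (k := 3) hk (by norm_num) ha hb hab
  have hgv : ¬G.Inc g v := fun hgv => (hgv.eq_or_eq_of_isLink hg).elim hvy hvz
  have hee' : e ≠ e' := by
    rintro rfl
    exact hyz (he.right_unique he')
  have hge : g ≠ e := fun h => hgv (h ▸ he.inc_left)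
  have hge' : g ≠ e' := fun h => hgv (h ▸ he'.inc_left)
  have hadj := lineGraph_adj_of_inc he.inc_left he'.inc_left hee'
  have hadjg := lineGraph_adj_of_inc he.inc_right hg.inc_left hge.symm
  have hadjg' := lineGraph_adj_of_inc he'.inc_right hg.inc_right hge'.symm
  have hdeg := degree_conflictGraph_add_le (k := 3) hk he.inc_left he' hg.inc_right hadj hadjg
    hge'.symm
  have hdeg' := degree_conflictGraph_add_le (k := 3) hk he'.inc_left he hg.inc_left hadj.symm
    hadjg' hge.symm
  refine isRoot_of_degree_le fun S hS ⟨f, hf⟩ => ?_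
  by_cases heS : e ∈ S
  · exact ⟨e, heS, by omega⟩
  by_cases heS' : e' ∈ S
  · exact ⟨e', heS', by omega⟩
  have hcard : 1 < #(incidenceFinset G v \ S) :=
    one_lt_card.2 ⟨e, by simp [he.inc_left, heS], e', by simp [he'.inc_left, heS'], hee'⟩
  have hfv := mem_incidenceFinset.1 (hS hf)
  have hfe := ne_of_mem_of_not_mem hf heS
  have hfe' := ne_of_mem_of_not_mem hf heS'
  have hfg : ∀ w, G.Inc f w → ¬G.Inc g w := by
    intro w hfw hgw
    rcases hgw.eq_or_eq_of_isLink hg with rfl | rfl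
    exacts [hpar ⟨f, e, w, hfe, isLink_of_inc_of_inc hfv hfw hvy, he⟩,
      hpar ⟨f, e', w, hfe', isLink_of_inc_of_inc hfv hfw hvz, he'⟩]
  have hadjf : ¬(lineGraph G).Adj f g := fun ⟨_, w, hfw, hgw⟩ => hfg w hfw hgw
  have := degree_conflictGraph_lt_of_common_neighbors (k := 3) hk
    (lineGraph_adj_of_inc hfv he.inc_left hfe) (lineGraph_adj_of_inc hfv he'.inc_left hfe') hee'
    hadjg hadjg' (fun h => hgv (h ▸ hfv)) hadjf
  exact ⟨f, hf, by omega⟩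

end RootCriteria

section SimpleComponent

variable {α β V : Type*} {G : Graph α β} {Γ : SimpleGraph V} {φ : V → α} {ed : V → V → β}
  {e f : β} {a b c d u v w y : V} {k n : ℕ}

/-- The vertices `φ a` form a union of components of `G` on which `G` has neither loops nor parallel
edges; `Γ` is the simple graph that `G` induces there, and `ed a b` is the edge from `φ a` to
`φ b`. -/
structure IsSimpleComponent (G : Graph α β) (Γ : SimpleGraph V) (φ : V → α) (ed : V → V → β) :
    Prop where
  injective : Function.Injective φ
  isLink {a b : V} (hab : Γ.Adj a b) : G.IsLink (ed a b) (φ a) (φ b)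
  exists_eq {e : β} {a : V} (he : G.Inc e (φ a)) : ∃ b, Γ.Adj a b ∧ e = ed a b

namespace IsSimpleComponent

variable (h : IsSimpleComponent G Γ φ ed)
include h

theorem adj_iff : G.Adj (φ a) (φ b) ↔ Γ.Adj a b := by
  refine ⟨fun ⟨e, he⟩ => ?_, fun hab => (h.isLink hab).adj⟩
  obtain ⟨c, hac, rfl⟩ := h.exists_eq he.inc_left
  rwa [h.injective (he.right_unique (h.isLink hac))]

theorem inc_iff (hab : Γ.Adj a b) : G.Inc (ed a b) (φ c) ↔ c = a ∨ c = b := by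
  refine ⟨fun hc => ?_, ?_⟩
  · exact (hc.eq_or_eq_of_isLink (h.isLink hab)).imp (@h.injective _ _) (@h.injective _ _)
  · rintro (rfl | rfl)
    exacts [(h.isLink hab).inc_left, (h.isLink hab).inc_right]

theorem ne_and_not_adj_of_separated {q q' : V × V} (hq : Γ.Adj q.1 q.2) (hq' : Γ.Adj q'.1 q'.2)
    (hfst : ¬Γ.Adj q.1 q'.1) (hsep : Separated Γ q q') {x y : α} (hx : G.Inc (ed q.1 q.2) x)
    (hy : G.Inc (ed q'.1 q'.2) y) : x ≠ y ∧ ¬G.Adj x y := by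
  rcases hx.eq_or_eq_of_isLink (h.isLink hq) with rfl | rfl <;>
    rcases hy.eq_or_eq_of_isLink (h.isLink hq') with rfl | rfl <;>
    rw [h.injective.ne_iff, h.adj_iff]
  · exact ⟨hsep.fst_ne, hfst⟩
  · exact ⟨fun heq => hfst (heq ▸ hq'.symm), hsep.not_adj_fst_snd⟩
  · exact ⟨fun heq => hfst (heq ▸ hq), hsep.not_adj_snd_fst⟩
  · exact ⟨fun heq => hsep.not_adj_fst_snd (heq ▸ hq), hsep.not_adj_snd_snd⟩

theorem injOn_edge_squares [Γ.LocallyFinite] (htri : Γ.CliqueFree 3) (hvu : Γ.Adj v u) :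
    Set.InjOn (fun p : V × V => ed p.1 p.2) (squares Γ v u) := by
  rintro ⟨y, w⟩ hyw ⟨y', w'⟩ hyw' (heq : ed y w = ed y' w')
  obtain ⟨-, ⟨huw, -⟩, hadj⟩ := mem_squares.1 hyw
  obtain ⟨⟨hvy', -⟩, -, hadj'⟩ := mem_squares.1 hyw'
  have hy' : y' = y ∨ y' = w := (h.inc_iff hadj).1 (heq ▸ (h.inc_iff hadj').2 (.inl rfl))
  have hw' : w' = y ∨ w' = w := (h.inc_iff hadj).1 (heq ▸ (h.inc_iff hadj').2 (.inr rfl))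
  obtain rfl : y' = y := hy'.resolve_right fun hy'w =>
    not_adj_of_cliqueFree_three htri hvu hvy' (hy'w ▸ huw)
  rw [hw'.resolve_left hadj'.ne']

theorem injOn_edge (a : V) : Set.InjOn (ed a) (Γ.neighborSet a) := by
  intro b hab c hac heq
  have hb := (h.isLink hab).inc_right
  rw [heq, h.inc_iff hac] at hb
  exact hb.resolve_left hab.ne'

theorem image_edge_neighborSet (a : V) : ed a '' Γ.neighborSet a = G.incidenceSet (φ a) := by
  ext e
  constructor
  · rintro ⟨b, hab, rfl⟩
    exact (h.isLink hab).inc_left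
  · intro he
    obtain ⟨b, hab, rfl⟩ := h.exists_eq he
    exact ⟨b, hab, rfl⟩

variable [∀ x, Finite (G.incidenceSet x)]

theorem edge_mem_far {g : β} {x z : α} (hvu : Γ.Adj v u) (hyw : Γ.Adj y w) (hyv : y ≠ v)
    (hyu : y ≠ u) (hwv : w ≠ v) (hwu : w ≠ u) (hx : G.Inc (ed v u) x) (hgx : G.Inc g x)
    (hgz : G.Inc g z) (hz : G.Inc (ed y w) z) : ed y w ∈ far (lineGraph G) (ed v u) g := by
  have hdisj : ∀ x, G.Inc (ed v u) x → ¬G.Inc (ed y w) x := by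
    intro x hx hyx
    rcases hyx.eq_or_eq_of_isLink (h.isLink hyw) with rfl | rfl
    exacts [((h.inc_iff hvu).1 hx).elim hyv hyu, ((h.inc_iff hvu).1 hx).elim hwv hwu]
  refine mem_far.2 ⟨lineGraph_adj_of_inc hgz hz ?_, ?_, fun ⟨_, x, hx, hyx⟩ => hdisj x hx hyx⟩
  · rintro rfl
    exact hdisj x hx hgx
  · intro heq
    exact hdisj x hx (heq ▸ hx)

theorem degree_conflictGraph_add_card_squares_le [Γ.LocallyFinite]
    (hk : ∀ x, #(incidenceFinset G x) ≤ k + 1) (htri : Γ.CliqueFree 3) (hvu : Γ.Adj v u) :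
    (conflictGraph G).degree (ed v u) + #(squares Γ v u) ≤ 2 * k * (k + 1) := by
  rw [← card_image_of_injOn (h.injOn_edge_squares htri hvu)]
  refine degree_conflictGraph_add_card_le hk fun f hf => ?_
  obtain ⟨⟨y, w⟩, hmem, rfl⟩ := mem_image.1 hf
  obtain ⟨⟨hvy, hyu⟩, ⟨huw, hwv⟩, hyw⟩ := mem_squares.1 hmem
  have hfar {g : β} {x z : α} := h.edge_mem_far (g := g) (x := x) (z := z) hvu hyw hvy.ne' hyu hwv
    huw.ne'
  have hv := (h.isLink hvu).inc_left
  have hu := (h.isLink hvu).inc_right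
  have hneg : ed v u ≠ ed v y := fun heq =>
    ((h.inc_iff hvy).1 (heq ▸ hu)).elim hvu.ne' hyu.symm
  have hneg' : ed v u ≠ ed u w := fun heq =>
    ((h.inc_iff huw).1 (heq ▸ hv)).elim hvu.ne hwv.symm
  have hne : ed v y ≠ ed u w := fun heq =>
    ((h.inc_iff huw).1 (heq ▸ (h.isLink hvy).inc_left)).elim hvu.ne hwv.symm
  exact ⟨ed v y, lineGraph_adj_of_inc hv (h.isLink hvy).inc_left hneg,
    ed u w, lineGraph_adj_of_inc hu (h.isLink huw).inc_left hneg', hne,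
    hfar hv (h.isLink hvy).inc_left (h.isLink hvy).inc_right (h.isLink hyw).inc_left,
    hfar hu (h.isLink huw).inc_left (h.isLink huw).inc_right (h.isLink hyw).inc_right⟩

theorem exists_isIndepSet_of_isInducedMatchingAt (htri : Γ.CliqueFree 3) {q : Fin k → V × V}
    (hq : IsInducedMatchingAt Γ v q) : ∃ P : Finset β, #P = k ∧ (conflictGraph G).IsIndepSet P ∧
      Disjoint P (incidenceFinset G (φ v)) ∧
      ∀ e, G.Inc e (φ v) → P ⊆ (conflictGraph G).neighborFinset e := by
  have hincompat {i j : Fin k} (hij : i ≠ j) {x y : α} :=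
    h.ne_and_not_adj_of_separated (x := x) (y := y) (hq.adj i) (hq.adj j)
      (not_adj_of_cliqueFree_three htri (hq.adj_fst i) (hq.adj_fst j)) (hq.separated hij)
  have hinj : Function.Injective fun i => ed (q i).1 (q i).2 := by
    intro i j (heq : ed (q i).1 (q i).2 = ed (q j).1 (q j).2)
    by_contra hij
    have hinc := (h.isLink (hq.adj i)).inc_left
    exact (hincompat hij hinc (heq ▸ hinc)).1 rfl
  have hoff (i : Fin k) : ¬G.Inc (ed (q i).1 (q i).2) (φ v) := fun hv =>
    ((h.inc_iff (hq.adj i)).1 hv).elim (hq.adj_fst i).ne (hq.snd_ne i).symm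
  refine ⟨univ.map ⟨_, hinj⟩, by rw [card_map, card_fin], ?_, ?_, fun e he f hf => ?_⟩
  · intro f hf f' hf' hne hadj
    obtain ⟨i, -, rfl⟩ := mem_map.1 hf
    obtain ⟨j, -, rfl⟩ := mem_map.1 hf'
    obtain ⟨-, x, y, hx, hy, hxy⟩ := conflictGraph_adj_iff.1 hadj
    have hij : i ≠ j := fun hij => hne (congrArg _ hij)
    exact hxy.elim (hincompat hij hx hy).1 (hincompat hij hx hy).2
  · refine disjoint_left.2 fun f hf hfv => ?_
    obtain ⟨i, -, rfl⟩ := mem_map.1 hf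
    exact hoff i (mem_incidenceFinset.1 hfv)
  · obtain ⟨i, -, rfl⟩ := mem_map.1 hf
    refine (SimpleGraph.mem_neighborFinset ..).2 (conflictGraph_adj_iff.2 ⟨?_, φ v, φ (q i).1, he,
      (h.isLink (hq.adj i)).inc_left, .inr (h.adj_iff.2 (hq.adj_fst i))⟩)
    rintro rfl
    exact hoff i he

theorem isRoot_of_isGoodRoot [Γ.LocallyFinite] (hk : ∀ x, #(incidenceFinset G x) ≤ 4)
    (htri : Γ.CliqueFree 3) (hv : IsGoodRoot Γ v) : IsRoot G 21 (φ v) := by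
  obtain ⟨k, q, hq, u, hu⟩ := hv
  obtain ⟨P, rfl, hP, hPv, hPadj⟩ := h.exists_isIndepSet_of_isInducedMatchingAt htri hq
  have hinj : Function.Injective fun i => ed v (u i) := by
    intro i j (heq : ed v (u i) = ed v (u j))
    have hinc := (h.isLink (hu i).1).inc_right
    rw [heq, h.inc_iff (hu j).1] at hinc
    exact u.injective (hinc.resolve_left (hu i).1.ne')
  refine isRoot_of_embedding (k := 3) hk (by norm_num) hP hPv hPadj ⟨_, hinj⟩
    (fun i => (h.isLink (hu i).1).inc_left) fun i => ?_
  have hdeg := h.degree_conflictGraph_add_card_squares_le (k := 3) hk htri (hu i).1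
  have hsave := (hu i).2
  change (conflictGraph G).degree (ed v (u i)) + 3 ≤ 24 + (#P - 1) + i
  omega

theorem finite_neighborSet (a : V) : (Γ.neighborSet a).Finite :=
  Set.Finite.of_finite_image (h.image_edge_neighborSet a ▸ Set.toFinite _) (h.injOn_edge a)

theorem degree_eq_card_incidenceFinset [Γ.LocallyFinite] (a : V) :
    Γ.degree a = #(incidenceFinset G (φ a)) := by
  have himage : (Γ.neighborFinset a).image (ed a) = incidenceFinset G (φ a) := by
    rw [← coe_inj, coe_image, SimpleGraph.coe_neighborFinset, h.image_edge_neighborSet]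
    ext e
    simp [Graph.mem_incidenceSet]
  rw [← himage, card_image_of_injOn (by simpa using h.injOn_edge a),
    SimpleGraph.card_neighborFinset_eq_degree]

theorem exists_isRoot_of_not_cliqueFree (hk : ∀ x, #(incidenceFinset G x) ≤ 4)
    (htri : ¬Γ.CliqueFree 3) : ∃ v, IsRoot G 21 (φ v) := by
  simp only [SimpleGraph.CliqueFree, not_forall, not_not] at htri
  obtain ⟨s, hs⟩ := htri
  obtain ⟨a, b, c, hab, hac, hbc, -⟩ := SimpleGraph.is3Clique_iff.1 hs
  exact ⟨a, isRoot_of_triangle hk (h.isLink hab) (h.isLink hac) (h.isLink hbc)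
    (h.injective.ne hab.ne) (h.injective.ne hac.ne) (h.injective.ne hbc.ne)⟩

theorem exists_isRoot [Nonempty V] (hk : ∀ x, #(incidenceFinset G x) ≤ 4) :
    ∃ v, IsRoot G 21 (φ v) := by
  by_cases htri : Γ.CliqueFree 3
  · have : Γ.LocallyFinite := fun a => @Fintype.ofFinite _ (h.finite_neighborSet a).to_subtype
    by_cases hreg : Γ.IsRegularOfDegree 4
    · obtain ⟨v, hv⟩ := exists_isGoodRoot hreg htri
      exact ⟨v, h.isRoot_of_isGoodRoot hk htri hv⟩
    · obtain ⟨v, hv⟩ := not_forall.1 hreg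
      rw [h.degree_eq_card_incidenceFinset] at hv
      exact ⟨v, isRoot_of_card_incidenceFinset_le (k := 3) hk (by norm_num)
        (Nat.lt_succ_iff.1 (lt_of_le_of_ne (hk _) hv))⟩
  · exact h.exists_isRoot_of_not_cliqueFree hk htri

end IsSimpleComponent

theorem exists_isSimpleComponent [Nonempty β] (C : G.toSimpleGraph.ConnectedComponent)
    (hloop : ∀ v ∈ C.supp, ∀ e, ¬G.IsLink e v v)
    (hpar : ∀ v ∈ C.supp, ∀ u e e', G.IsLink e v u → G.IsLink e' v u → e = e') :
    ∃ ed, IsSimpleComponent G C.toSimpleGraph (fun a => a.1.1) ed := by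
  have hexists (a b : C) (hab : C.toSimpleGraph.Adj a b) : ∃ e, G.IsLink e a.1 b.1 := hab.2
  choose! ed hed using hexists
  refine ⟨ed, Subtype.val_injective.comp Subtype.val_injective, hed _ _, fun {e a} ⟨x, he⟩ => ?_⟩
  have hax : a.1 ≠ ⟨x, he.right_mem⟩ := by
    intro hax
    obtain rfl : a.1.1 = x := congrArg Subtype.val hax
    exact hloop a.1 a.2 e he
  have hadj : G.toSimpleGraph.Adj a.1 ⟨x, he.right_mem⟩ := ⟨hax, he.adj⟩
  refine ⟨⟨⟨x, he.right_mem⟩, ?_⟩, hadj, ?_⟩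
  · exact C.mem_supp_of_adj_mem_supp a.2 hadj
  · exact hpar a.1 a.2 x e _ he (hed _ _ hadj)

theorem exists_isRoot [∀ x, Finite (G.incidenceSet x)]
    (hk : ∀ x, #(incidenceFinset G x) ≤ 4)
    (hloop : ∀ x e, G.IsLink e x x → #(incidenceFinset G x) ≤ 3)
    (C : G.toSimpleGraph.ConnectedComponent) : ∃ v ∈ C.supp, IsRoot G 21 v := by
  by_contra! hroot
  have hC : Nonempty C := C.nonempty_supp.to_subtype
  have hβ : Nonempty β := by
    obtain ⟨v, hv⟩ := C.nonempty_supp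
    by_contra hβ
    rw [not_nonempty_iff] at hβ
    exact hroot v hv (isRoot_of_forall_degree_le isEmptyElim)
  obtain ⟨ed, h⟩ := exists_isSimpleComponent C
    (fun v hv e he => hroot v hv
      (isRoot_of_card_incidenceFinset_le (k := 3) hk (by norm_num) (hloop _ e he)))
    (fun v hv u e e' he he' => of_not_not fun hne => hroot v hv
      (isRoot_of_parallel (k := 3) hk (by norm_num) he he' hne))
  obtain ⟨v, hv⟩ := h.exists_isRoot hk
  exact hroot v.1 v.2 hv

end SimpleComponent

section Degree

variable {α β : Type*} {G : Graph α β} {d : ℕ}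

theorem degree_le_of_forall_mem (hdeg : ∀ v ∈ G.vertexSet, G.degree v ≤ d) (x : α) :
    G.degree x ≤ d := by
  by_cases hx : x ∈ G.vertexSet
  · exact hdeg x hx
  have hempty : G.incidenceSet x = ∅ :=
    Set.eq_empty_of_forall_notMem fun _ he => hx (Graph.Inc.vertex_mem he)
  have hempty' : G.loopSet x = ∅ :=
    Set.subset_empty_iff.1 (hempty ▸ G.loopSet_subset_incidenceSet x)
  simp [Graph.degree, hempty, hempty']

theorem finite_incidenceSet_of_degree_le {x : α} (hx : G.degree x ≤ d) :
    Finite (G.incidenceSet x) :=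
  (Set.finite_of_encard_le_coe (le_self_add.trans hx)).to_subtype

theorem card_incidenceFinset_le [∀ x, Finite (G.incidenceSet x)] {x : α} (hx : G.degree x ≤ d) :
    #(incidenceFinset G x) ≤ d := by
  have hcard := (G.incidenceSet x).toFinite.encard_eq_coe_toFinset_card
  exact_mod_cast hcard ▸ le_self_add.trans hx

theorem card_incidenceFinset_lt_of_loop [∀ x, Finite (G.incidenceSet x)] {x : α} {e : β}
    (hx : G.degree x ≤ d) (he : G.IsLink e x x) : #(incidenceFinset G x) < d := by
  have hcard := (G.incidenceSet x).toFinite.encard_eq_coe_toFinset_card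
  have hloop : 1 ≤ (G.loopSet x).encard := Set.one_le_encard_iff_nonempty.2 ⟨e, he⟩
  have hsum := (add_le_add_right hloop _).trans hx
  rw [hcard] at hsum
  exact_mod_cast hsum

end Degree

end

end StrongEdgeColoring

open StrongEdgeColoring in
theorem mainTheorem1_general {α β : Type*} (G : Graph α β)
    (hdeg : ∀ v ∈ G.vertexSet, G.degree v ≤ 4) :
    ∃ c : β → Fin 22, G.IsStrongEdgeColoring c := by
  have hdeg' := degree_le_of_forall_mem (d := 4) hdeg
  have : ∀ x, Finite (G.incidenceSet x) := fun x => finite_incidenceSet_of_degree_le (hdeg' x)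
  have hcard x : (incidenceFinset G x).card ≤ 4 := card_incidenceFinset_le (hdeg' x)
  have hloop x e (he : G.IsLink e x x) : (incidenceFinset G x).card ≤ 3 :=
    Nat.lt_succ_iff.1 (card_incidenceFinset_lt_of_loop (hdeg' x) he)
  obtain ⟨c⟩ := conflictGraph_colorable (k := 3) hcard le_rfl (exists_isRoot hcard hloop)
  exact ⟨c, isStrongEdgeColoring_of_coloring c⟩

theorem mainTheorem1 {α β : Type*} (G : Graph α β)
    (hV : G.vertexSet.Finite) (hE : G.edgeSet.Finite)
    (hdeg : ∀ v ∈ G.vertexSet, G.degree v ≤ 4) :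
    ∃ c : β → Fin 22, G.IsStrongEdgeColoring c :=
  mainTheorem1_general G hdeg
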